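/- Let $\Lambda=\Lambda_0\oplus\Lambda_1$ be a finite-dimensional real unital associative $\mathbb{Z}/2$-graded algebra that is supercommutative, i.e. $ab=(-1)^{\sigma(a)\sigma(b)}ba$ for homogeneous $a,b$ of parities $\sigma(a),\sigma(b)$. Assume: $(A_0)$ $(e_0=1,e_1,\dots,e_p)$ is a basis of $\Lambda_0$ with $\sum_{k=0}^p e_k^2=0$; $(A_1)$ $(\varepsilon_1,\dots,\varepsilon_q)$ is a basis of $\Lambda_1$, and there are integers $1=s_1<s_2<\dots<s_{r+1}=q+1$ and elements $a_1,\dots,a_q\in\Lambda_0$ such that for every $k=1,\dots,r$: $\varepsilon_j=a_j\varepsilon_{s_k}$ for $s_k\le j<s_{k+1}$, $a_{s_k}=1$, and $\sum_{j=s_k}^{s_{k+1}-1}a_j^2=0$. Write points of $\Lambda_0^n\times\Lambda_1^m$ as $(y_1,\dots,y_n,\theta_1,\dots,\theta_m)$ with $y_i=\sum_{j=0}^p y_i^je_j$ and $\theta_l=\sum_{t=1}^q\theta_l^t\varepsilon_t$. A function $f:D\to\Lambda$ on an open set $D\subset\Lambda_0^n\times\Lambda_1^m$ is called qS-differentiable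 on $D$ if it is (real) Fréchet-differentiable at every point of $D$ and $d''f=0$ on $D$, where $$d''f=\sum_{i=1}^n\sum_{j=1}^p\Big(\frac{\partial f}{\partial y_i^j}-e_j\frac{\partial f}{\partial y_i^0}\Big)dy_i^j+\sum_{l=1}^m\sum_{k=1}^r\sum_{t=s_k+1}^{s_{k+1}-1}\Big(\frac{\partial f}{\partial\theta_l^t}-a_t\frac{\partial f}{\partial\theta_l^{s_k}}\Big)d\theta_l^t .$$ Let $n+m\ge 2$, and if $\Lambda_1=0$ let $n\ge2$. Let $\Omega$ be a bounded domain (non-empty connected open set) of $\Lambda_0^n\times\Lambda_1^m$ whose boundary $\partial\Omega$ is connected, let $V$ be an open neighbourhood of $\partial\Omega$, and let $f:V\to\Lambda$ be qS-differentiable on $V$. Then $f$ extends to a qS-differentiable function on $\Omega$: if $V_0$ denotes the connected component of $V$ containing $\partial\Omega$, there is a qS-differentiable function $F:\Omega\cup V_0\to\Lambda$ with $F=f$ on $V_0$. -/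

import Mathlib

namespace SuperAnalysis

/-- Supercommutativity of a `ℤ/2`-graded algebra: `ab = (-1)^{σ(a)σ(b)} ba` for homogeneous
`a`, `b`. -/
def IsSupercommutative {Λ : Type*} [Ring Λ] [Algebra ℝ Λ] (𝒜 : ZMod 2 → Submodule ℝ Λ) : Prop :=
  ∀ (i j : ZMod 2) (a b : Λ), a ∈ 𝒜 i → b ∈ 𝒜 j → a * b = (-1) ^ (i.val * j.val) * (b * a)

/-- The superspace `Λ₀ⁿ × Λ₁ᵐ`. -/
abbrev Superspace {Λ : Type*} [Ring Λ] [Algebra ℝ Λ] (𝒜 : ZMod 2 → Submodule ℝ Λ) (n m : ℕ) :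
    Type _ :=
  (Fin n → 𝒜 0) × (Fin m → 𝒜 1)

/-- A sequence `s₀ = 0 < s₁ < ⋯ < s_r = q`, cutting the index set `{0, …, q - 1}` into the `r`
nonempty consecutive blocks `{s_k, …, s_{k+1} - 1}`. Indices are shifted by one with respect to
the usual numbering `1 = s₁ < ⋯ < s_{r+1} = q + 1`. -/
structure BlockSeq (q r : ℕ) where
  s : Fin (r + 1) → ℕ
  strictMono : StrictMono s
  s_zero : s 0 = 0
  s_last : s (Fin.last r) = q

/-- The first index `s_k` of the `k`-th block. -/
def BlockSeq.lead {q r : ℕ} (S : BlockSeq q r) (k : Fin r) : Fin q :=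
  ⟨S.s k.castSucc, lt_of_lt_of_eq (S.strictMono (Fin.castSucc_lt_last k)) S.s_last⟩

/-- The `k`-th block of indices `s_k ≤ j < s_{k+1}`. -/
def BlockSeq.block {q r : ℕ} (S : BlockSeq q r) (k : Fin r) : Finset (Fin q) :=
  Finset.univ.filter fun j => S.s k.castSucc ≤ (j : ℕ) ∧ (j : ℕ) < S.s k.succ

section

variable {Λ : Type*} [NormedRing Λ] [NormedAlgebra ℝ Λ] (𝒜 : ZMod 2 → Submodule ℝ Λ)

/-- Condition `(A₀)` for the basis `(e₀, …, e_p)` of `Λ₀`: `e₀ = 1` and `∑ e_k² = 0`. -/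
def ConditionA0 {p : ℕ} (e : Module.Basis (Fin (p + 1)) ℝ (𝒜 0)) : Prop :=
  (e 0 : Λ) = 1 ∧ ∑ k, (e k : Λ) ^ 2 = 0

/-- Condition `(A₁)` for the basis `ε` of `Λ₁`, the blocks `S` and the even elements `a_j`:
on each block `ε_j = a_j ε_{s_k}`, `a_{s_k} = 1` and `∑ a_j² = 0`. -/
def ConditionA1 {q r : ℕ} (ε : Module.Basis (Fin q) ℝ (𝒜 1)) (S : BlockSeq q r)
    (a : Fin q → 𝒜 0) : Prop :=
  ∀ k : Fin r,
    (∀ j ∈ S.block k, (ε j : Λ) = (a j : Λ) * (ε (S.lead k) : Λ)) ∧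
    (a (S.lead k) : Λ) = 1 ∧
    ∑ j ∈ S.block k, (a j : Λ) ^ 2 = 0

variable {𝒜} {n m : ℕ}

/-- The real coordinate `x = (y, θ) ↦ y_i^j`, which is also the constant `1`-form `dy_i^j`. -/
noncomputable def dy {p : ℕ} (e : Module.Basis (Fin (p + 1)) ℝ (𝒜 0)) (i : Fin n)
    (j : Fin (p + 1)) : Superspace 𝒜 n m →ₗ[ℝ] ℝ :=
  e.coord j ∘ₗ LinearMap.proj i ∘ₗ LinearMap.fst ℝ (Fin n → 𝒜 0) (Fin m → 𝒜 1)

/-- The real coordinate `x = (y, θ) ↦ θ_l^t`, which is also the constant `1`-form `dθ_l^t`. -/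
noncomputable def dθ {q : ℕ} (ε : Module.Basis (Fin q) ℝ (𝒜 1)) (l : Fin m)
    (t : Fin q) : Superspace 𝒜 n m →ₗ[ℝ] ℝ :=
  ε.coord t ∘ₗ LinearMap.proj l ∘ₗ LinearMap.snd ℝ (Fin n → 𝒜 0) (Fin m → 𝒜 1)

/-- The real partial derivative `∂f/∂y_i^j`. -/
noncomputable def partialY {p : ℕ} (e : Module.Basis (Fin (p + 1)) ℝ (𝒜 0))
    (f : Superspace 𝒜 n m → Λ) (x : Superspace 𝒜 n m) (i : Fin n) (j : Fin (p + 1)) : Λ :=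
  fderiv ℝ f x (Pi.single i (e j), 0)

/-- The real partial derivative `∂f/∂θ_l^t`. -/
noncomputable def partialθ {q : ℕ} (ε : Module.Basis (Fin q) ℝ (𝒜 1))
    (f : Superspace 𝒜 n m → Λ) (x : Superspace 𝒜 n m) (l : Fin m) (t : Fin q) : Λ :=
  fderiv ℝ f x (0, Pi.single l (ε t))

/-- The Cauchy–Riemann operator on functions: the `Λ`-valued `1`-form
`d''f = ∑_i ∑_{j ≥ 1} dy_i^j (∂f/∂y_i^j - e_j ∂f/∂y_i^0)
  + ∑_l ∑_k ∑_{s_k < t < s_{k+1}} dθ_l^t (∂f/∂θ_l^t - a_t ∂f/∂θ_l^{s_k})`. -/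
noncomputable def cauchyRiemann {p q r : ℕ} (e : Module.Basis (Fin (p + 1)) ℝ (𝒜 0))
    (ε : Module.Basis (Fin q) ℝ (𝒜 1)) (S : BlockSeq q r) (a : Fin q → 𝒜 0)
    (f : Superspace 𝒜 n m → Λ) (x : Superspace 𝒜 n m) : Superspace 𝒜 n m →ₗ[ℝ] Λ :=
  (∑ i : Fin n, ∑ j : Fin p,
    (dy e i j.succ).smulRight
      (partialY e f x i j.succ - (e j.succ : Λ) * partialY e f x i 0)) +
  ∑ l : Fin m, ∑ k : Fin r, ∑ t ∈ (S.block k).erase (S.lead k),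
    (dθ ε l t).smulRight
      (partialθ ε f x l t - (a t : Λ) * partialθ ε f x l (S.lead k))

/-- `f` is quasi-superdifferentiable (qS-differentiable) on the open set `D`: it is
Fréchet-differentiable at every point of `D` and `d''f = 0` on `D`. -/
def QSDifferentiableOn {p q r : ℕ} (e : Module.Basis (Fin (p + 1)) ℝ (𝒜 0))
    (ε : Module.Basis (Fin q) ℝ (𝒜 1)) (S : BlockSeq q r) (a : Fin q → 𝒜 0)
    (f : Superspace 𝒜 n m → Λ) (D : Set (Superspace 𝒜 n m)) : Prop :=
  ∀ x ∈ D, DifferentiableAt ℝ f x ∧ cauchyRiemann e ε S a f x = 0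

end

end SuperAnalysis

/-! In real coordinates the equations read `∂_t f = A_t ∂_{ℓ(t)} f`, where `ℓ(t)` is the leading
coordinate of the block of `t` and `A_t` is multiplication by an even element. Even elements commute
by supercommutativity, and the conditions on the bases say that `∑ A_t² = 0` over each block. Hence
`∑_t (∂_t + A_t ∂_{ℓ(t)})(∂_t - A_t ∂_{ℓ(t)}) = Δ`: the system factors the Laplacian, as `∂̄` does
in complex analysis.

The gradient of the Newton kernel therefore gives a Cauchy–Pompeiu formula (`CRSystem.pot_dbar`).
Multiplied by a cutoff, a solution becomes the potential of a density involving no derivative of it.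
This yields smoothness, the identity theorem (`CRSystem.IsSolOn.eqOn_zero`) and, by rescaling,
Liouville's theorem (`CRSystem.IsSolOn.eq_zero_of_tendsto`). The same potential solves the
inhomogeneous system with compatible, compactly supported data, with decay at infinity
(`CRSystem.exists_dbar_eq`).

Extension follows Ehrenpreis's proof of Hartogs' theorem (`CRSystem.IsSolOn.exists_extension`). Cut
`f` off to a smooth `g` on `Ω ∪ V`, equal to `f` off a compact `T ⊆ Ω`; solve `d''u = d''g` with `u
→ 0`; put `F = g - u`. Because there is a second block, slices along the variables of one block can
avoid `T`; there `u` is an entire solution tending to zero, so it vanishes. The identity theorem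
carries `u = 0` along a ray to a boundary point of `Ω`, and then `F = f` to all of the connected
neighbourhood. -/

namespace SuperAnalysis

open MeasureTheory Filter Topology Set Bornology
open scoped ContDiff Convolution Manifold

section CRSystem

set_option linter.unusedSectionVars false

/-! ### Divergence theorem for compactly supported fields. -/

/-- The integral over `ℝⁿ⁺¹` of the divergence of a compactly supported differentiable vector field
vanishes, provided that the divergence is integrable. -/
theorem integral_divergence_eq_zero_fin {W : Type*} [NormedAddCommGroup W] [NormedSpace ℝ W]
    {n : ℕ} (f : Fin (n + 1) → (Fin (n + 1) → ℝ) → W) (hd : ∀ i, Differentiable ℝ (f i))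
    (hc : ∀ i, HasCompactSupport (f i))
    (hi : Integrable fun x => ∑ i, fderiv ℝ (f i) x (Pi.single i 1)) :
    ∫ x, ∑ i, fderiv ℝ (f i) x (Pi.single i 1) = 0 := by
  obtain ⟨R, hR⟩ : ∃ R : ℝ, ∀ i, tsupport (f i) ⊆ Metric.ball 0 R := by
    have hK : IsCompact (⋃ i, tsupport (f i)) := isCompact_iUnion fun i => hc i
    obtain ⟨R, hR⟩ := hK.isBounded.subset_ball 0
    exact ⟨R, fun i => (subset_iUnion (fun i => tsupport (f i)) i).trans hR⟩
  -- The maximum with `0` keeps the box `[-R', R']ⁿ⁺¹` nonempty even if `R` is negative, which can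
  -- happen when all supports are empty.
  set R' : ℝ := max R 0
  have hz : ∀ i x, R' ≤ ‖x‖ → f i x = 0 := fun i x hx => by
    refine image_eq_zero_of_notMem_tsupport fun h => ?_
    have := hR i h
    rw [mem_ball_zero_iff] at this
    exact absurd (this.trans_le (le_max_left R 0)) (not_lt.2 hx)
  set a : Fin (n + 1) → ℝ := fun _ => -R'
  set b : Fin (n + 1) → ℝ := fun _ => R'
  have hR0 : 0 ≤ R' := le_max_right _ _
  have key := integral_divergence_of_hasFDerivAt_off_countable' a b
    (fun i => by simp only [a, b]; linarith) f (fun i x => fderiv ℝ (f i) x) ∅ countable_empty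
    (fun i => (hd i).continuous.continuousOn) (fun x _ i => (hd i x).hasFDerivAt) hi.integrableOn
  have hface : ∀ (i : Fin (n + 1)) (c : ℝ), |c| = R' → ∀ x : Fin n → ℝ,
      f i (i.insertNth c x) = 0 := fun i c hcR x => by
    refine hz i _ ?_
    have := norm_le_pi_norm (i.insertNth c x : Fin (n + 1) → ℝ) i
    rwa [Fin.insertNth_apply_same, Real.norm_eq_abs, hcR] at this
  rw [← setIntegral_eq_integral_of_forall_compl_eq_zero (s := Icc a b), key]
  · refine Finset.sum_eq_zero fun i _ => ?_
    simp [a, b, hface i R' (abs_of_nonneg hR0), hface i (-R') (by simp [abs_of_nonneg hR0])]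
  · intro x hx
    refine Finset.sum_eq_zero fun i _ => ?_
    have : x ∉ tsupport (f i) := fun h => hx <| by
      have := hR i h
      rw [mem_ball_zero_iff] at this
      have h2 := fun j => (norm_le_pi_norm x j).trans (this.le.trans (le_max_left R 0))
      exact ⟨fun j => (abs_le.1 (h2 j)).1, fun j => (abs_le.1 (h2 j)).2⟩
    have h0 : fderiv ℝ (f i) x = 0 :=
      image_eq_zero_of_notMem_tsupport fun h => this (tsupport_fderiv_subset ℝ h)
    simp [h0]

/-- The divergence theorem for compactly supported vector fields on Euclidean space. -/
theorem integral_divergence_eq_zero {W : Type*} [NormedAddCommGroup W] [NormedSpace ℝ W]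
    {ι : Type*} [Fintype ι] [DecidableEq ι] [Nonempty ι] (f : ι → EuclideanSpace ℝ ι → W)
    (hd : ∀ i, Differentiable ℝ (f i)) (hc : ∀ i, HasCompactSupport (f i))
    (hi : Integrable fun x => ∑ i, fderiv ℝ (f i) x (EuclideanSpace.single i 1)) :
    ∫ x, ∑ i, fderiv ℝ (f i) x (EuclideanSpace.single i 1) = 0 := by
  obtain ⟨n, hn⟩ : ∃ n, Fintype.card ι = n + 1 :=
    Nat.exists_eq_succ_of_ne_zero Fintype.card_ne_zero
  let σ : ι ≃ Fin (n + 1) := Fintype.equivFinOfCardEq hn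
  let I : EuclideanSpace ℝ (Fin (n + 1)) ≃ₗᵢ[ℝ] EuclideanSpace ℝ ι :=
    LinearIsometryEquiv.piLpCongrLeft 2 ℝ ℝ σ.symm
  let J : (Fin (n + 1) → ℝ) ≃L[ℝ] EuclideanSpace ℝ (Fin (n + 1)) :=
    (EuclideanSpace.equiv (Fin (n + 1)) ℝ).symm
  let L : (Fin (n + 1) → ℝ) ≃L[ℝ] EuclideanSpace ℝ ι := J.trans I.toContinuousLinearEquiv
  have hL : MeasurePreserving L volume volume :=
    I.measurePreserving.comp (PiLp.volume_preserving_toLp (Fin (n + 1)))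
  have hLe : MeasurableEmbedding L := L.toHomeomorph.measurableEmbedding
  have hLs : ∀ i, L (Pi.single i 1) = EuclideanSpace.single (σ.symm i) 1 := fun i => by
    ext j
    simp [L, J, I, EuclideanSpace.equiv,
      Equiv.eq_symm_apply]
  have hsum : ∀ x, ∑ i, fderiv ℝ (f i) (L x) (EuclideanSpace.single i 1)
      = ∑ i, fderiv ℝ (fun y => f (σ.symm i) (L y)) x (Pi.single i 1) := fun x => by
    rw [← σ.symm.sum_comp]
    refine Finset.sum_congr rfl fun i _ => ?_
    have : fderiv ℝ (fun y => f (σ.symm i) (L y)) x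
        = (fderiv ℝ (f (σ.symm i)) (L x)).comp (L : (Fin (n + 1) → ℝ) →L[ℝ] _) :=
      ((hd _ _).hasFDerivAt.comp x L.hasFDerivAt).fderiv
    rw [this]
    simp [hLs]
  rw [← hL.integral_comp hLe]
  simp_rw [hsum]
  refine integral_divergence_eq_zero_fin _ (fun i => (hd _).comp L.differentiable)
    (fun i => (hc _).comp_homeomorph L.toHomeomorph) ?_
  simp_rw [← hsum]
  exact (hL.integrable_comp_emb hLe).2 hi

/-! ### Systems of Cauchy–Riemann type and integration by parts. -/

/-- The data of a system `∂_t f = A_t ∂_{ℓ(t)} f` of Cauchy–Riemann type: the coefficients `A_t`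
commute, and `∑ A_t² = 0` over each block, a block being a fibre of `ℓ`. -/
structure CRSystem (ι W : Type*) [Fintype ι] [DecidableEq ι] [NormedAddCommGroup W]
    [NormedSpace ℝ W] where
  lead : ι → ι
  coeff : ι → W →L[ℝ] W
  comm : ∀ s t w, coeff s (coeff t w) = coeff t (coeff s w)
  sum_sq : ∀ b w, ∑ t with lead t = b, coeff t (coeff t w) = 0

variable {ι W : Type*} [Fintype ι] [DecidableEq ι] [NormedAddCommGroup W] [NormedSpace ℝ W]

/-- The component `∂_t f - A_t ∂_{ℓ(t)} f` of the Cauchy–Riemann operator. -/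
noncomputable def CRSystem.dbar (C : CRSystem ι W) (t : ι) (f : EuclideanSpace ℝ ι → W)
    (x : EuclideanSpace ℝ ι) : W :=
  fderiv ℝ f x (EuclideanSpace.single t 1) -
    C.coeff t (fderiv ℝ f x (EuclideanSpace.single (C.lead t) 1))

theorem CRSystem.integral_dbar_eq_zero [Nonempty ι] (C : CRSystem ι W) (t : ι)
    {ψ : EuclideanSpace ℝ ι → W} (hd : Differentiable ℝ ψ) (hc : HasCompactSupport ψ)
    (hi : Integrable (C.dbar t ψ)) : ∫ x, C.dbar t ψ x = 0 := by
  -- With these constant operators, `dbar t ψ` is the divergence of the field `i ↦ c i ψ`.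
  let c : ι → W →L[ℝ] W := fun i =>
    (if i = t then ContinuousLinearMap.id ℝ W else 0) - (if i = C.lead t then C.coeff t else 0)
  have hfd : ∀ i x, fderiv ℝ (fun y => c i (ψ y)) x = (c i).comp (fderiv ℝ ψ x) := fun i x =>
    ((c i).hasFDerivAt.comp x (hd x).hasFDerivAt).fderiv
  have hsum : ∀ x, C.dbar t ψ x
      = ∑ i, fderiv ℝ (fun y => c i (ψ y)) x (EuclideanSpace.single i 1) := fun x => by
    have h1 : ∀ i, (if i = t then ContinuousLinearMap.id ℝ W else 0)
        (fderiv ℝ ψ x (EuclideanSpace.single i 1))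
        = if i = t then fderiv ℝ ψ x (EuclideanSpace.single i 1) else 0 := fun i => by
      split_ifs <;> simp
    have h2 : ∀ i, (if i = C.lead t then C.coeff t else 0)
        (fderiv ℝ ψ x (EuclideanSpace.single i 1))
        = if i = C.lead t then C.coeff t (fderiv ℝ ψ x (EuclideanSpace.single i 1)) else 0 :=
      fun i => by split_ifs <;> simp
    simp_rw [hfd]
    simp only [c, CRSystem.dbar, ContinuousLinearMap.comp_apply, sub_apply, h1, h2,
      Finset.sum_sub_distrib, Finset.sum_ite_eq', Finset.mem_univ, if_true]
  simp_rw [hsum]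
  refine integral_divergence_eq_zero _ (fun i => (c i).differentiable.comp hd)
    (fun i => hc.comp_left (map_zero (c i))) ?_
  simp_rw [← hsum]
  exact hi

theorem CRSystem.hasCompactSupport_dbar (C : CRSystem ι W) (t : ι)
    {φ : EuclideanSpace ℝ ι → W} (hc : HasCompactSupport φ) :
    HasCompactSupport (C.dbar t φ) := by
  refine hc.mono' fun y hy => ?_
  contrapose! hy
  have h0 : fderiv ℝ φ y = 0 :=
    image_eq_zero_of_notMem_tsupport fun h => hy (tsupport_fderiv_subset ℝ h)
  simp [CRSystem.dbar, h0]

/-- Integration by parts for a component of the Cauchy–Riemann operator. -/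
theorem CRSystem.integral_smul_dbar [Nonempty ι] (C : CRSystem ι W) (t : ι)
    {κ : EuclideanSpace ℝ ι → ℝ} (hκ : ContDiff ℝ 1 κ) {φ : EuclideanSpace ℝ ι → W}
    (hd : Differentiable ℝ φ) (hc : HasCompactSupport φ) (hcont : Continuous (C.dbar t φ))
    (x : EuclideanSpace ℝ ι) :
    ∫ y, κ y • C.dbar t φ (x - y) =
      ∫ y, (fderiv ℝ κ y (EuclideanSpace.single t 1) • φ (x - y) -
        C.coeff t (fderiv ℝ κ y (EuclideanSpace.single (C.lead t) 1) • φ (x - y))) := by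
  have hsub : ∀ y, HasFDerivAt (fun y => φ (x - y)) (-(fderiv ℝ φ (x - y))) y := fun y => by
    have h1 : HasFDerivAt (fun y => x - y)
        (-ContinuousLinearMap.id ℝ (EuclideanSpace ℝ ι)) y := (hasFDerivAt_id y).const_sub x
    have h2 : -(fderiv ℝ φ (x - y)) = (fderiv ℝ φ (x - y)).comp
        (-ContinuousLinearMap.id ℝ (EuclideanSpace ℝ ι)) := by ext; simp
    rw [h2]
    exact (hd (x - y)).hasFDerivAt.comp y h1
  have hψ : ∀ y, HasFDerivAt (fun y => κ y • φ (x - y))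
      (κ y • (-(fderiv ℝ φ (x - y))) + (fderiv ℝ κ y).smulRight (φ (x - y))) y := fun y =>
    ((hκ.differentiable one_ne_zero) y).hasFDerivAt.smul (hsub y)
  have hsubc : Continuous fun y : EuclideanSpace ℝ ι => x - y := by fun_prop
  -- Leibniz rule; the reflection `y ↦ x - y` produces the minus sign, so that both integrals end up
  -- with the same sign.
  have hD : ∀ y, C.dbar t (fun y => κ y • φ (x - y)) y =
      (fderiv ℝ κ y (EuclideanSpace.single t 1) • φ (x - y) -
        C.coeff t (fderiv ℝ κ y (EuclideanSpace.single (C.lead t) 1) • φ (x - y))) -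
        κ y • C.dbar t φ (x - y) := fun y => by
    simp only [CRSystem.dbar, (hψ y).fderiv]
    simp
    module
  have hcs : HasCompactSupport fun y => φ (x - y) :=
    hc.comp_homeomorph (Homeomorph.subLeft x)
  have hi1 : Integrable fun y => (fderiv ℝ κ y (EuclideanSpace.single t 1) • φ (x - y) -
        C.coeff t (fderiv ℝ κ y (EuclideanSpace.single (C.lead t) 1) • φ (x - y))) := by
    have hk : ∀ v, Continuous fun y => fderiv ℝ κ y v := fun v =>
      (hκ.continuous_fderiv one_ne_zero).clm_apply continuous_const
    have h1 : ∀ v, Continuous fun y => fderiv ℝ κ y v • φ (x - y) := fun v =>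
      (hk v).smul (hd.continuous.comp hsubc)
    exact ((h1 _).integrable_of_hasCompactSupport hcs.smul_left).sub
      ((C.coeff t).integrable_comp
        ((h1 _).integrable_of_hasCompactSupport hcs.smul_left))
  have hcD := C.hasCompactSupport_dbar t hc
  have hi2 : Integrable fun y => κ y • C.dbar t φ (x - y) :=
    (hκ.continuous.smul (hcont.comp hsubc)).integrable_of_hasCompactSupport
      (HasCompactSupport.smul_left (hcD.comp_homeomorph (Homeomorph.subLeft x)))
  have h0 := C.integral_dbar_eq_zero t (ψ := fun y => κ y • φ (x - y))
    (fun y => (hψ y).differentiableAt) hcs.smul_left (by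
      rw [show C.dbar t (fun y => κ y • φ (x - y)) = _ from funext hD]
      exact hi1.sub hi2)
  simp_rw [hD] at h0
  rw [integral_sub hi1 hi2, sub_eq_zero] at h0
  exact h0.symm

/-! ### The regularized kernel and the Cauchy–Pompeiu formula. -/

/-- The regularized kernel `y_t / (|y|² + ε)^{N/2}` on `ℝᴺ`. -/
noncomputable def kerReg (ε : ℝ) (t : ι) (y : EuclideanSpace ℝ ι) : ℝ :=
  y t * (‖y‖ ^ 2 + ε) ^ (-(Fintype.card ι / 2 : ℝ))

theorem contDiffAt_kerReg {ε : ℝ} (t : ι) {y : EuclideanSpace ℝ ι} (h : 0 < ‖y‖ ^ 2 + ε) :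
    ContDiffAt ℝ ∞ (kerReg ε t) y := by
  refine ContDiffAt.mul (by fun_prop) (ContDiffAt.rpow_const_of_ne ?_ h.ne')
  exact ((contDiff_norm_sq ℝ).add contDiff_const).contDiffAt

theorem fderiv_kerReg {ε : ℝ} (s t : ι) {y : EuclideanSpace ℝ ι} (h : 0 < ‖y‖ ^ 2 + ε) :
    fderiv ℝ (kerReg ε s) y (EuclideanSpace.single t 1) =
      (if s = t then (‖y‖ ^ 2 + ε) ^ (-(Fintype.card ι / 2 : ℝ)) else 0) -
        Fintype.card ι * y s * y t * (‖y‖ ^ 2 + ε) ^ (-(Fintype.card ι / 2 : ℝ) - 1) := by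
  have h1 : HasFDerivAt (fun y : EuclideanSpace ℝ ι => ‖y‖ ^ 2 + ε) (2 • innerSL ℝ y) y :=
    (hasStrictFDerivAt_norm_sq y).hasFDerivAt.add_const ε
  have h2 := h1.rpow_const (p := -(Fintype.card ι / 2 : ℝ)) (Or.inl h.ne')
  have h3 : HasFDerivAt (fun y : EuclideanSpace ℝ ι => y s)
      (EuclideanSpace.proj s : EuclideanSpace ℝ ι →L[ℝ] ℝ) y :=
    (EuclideanSpace.proj s : EuclideanSpace ℝ ι →L[ℝ] ℝ).hasFDerivAt
  have h4 := (h3.mul h2).fderiv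
  change fderiv ℝ (kerReg ε s) y = _ at h4
  rw [h4]
  simp [EuclideanSpace.inner_single_right]
  split_ifs <;> ring

/-- The kernel `y_t / |y|ᴺ` on `ℝᴺ`. -/
noncomputable def ker (t : ι) (y : EuclideanSpace ℝ ι) : ℝ := kerReg 0 t y

theorem abs_coord_le (t : ι) (y : EuclideanSpace ℝ ι) : |y t| ≤ ‖y‖ :=
  PiLp.norm_apply_le y t

/-- The bound does not depend on `ε` and is locally integrable on `ℝᴺ`, so it serves as the
dominating function when `ε → 0`. -/
theorem norm_kerReg_le {ε : ℝ} (hε : 0 ≤ ε) (t : ι) {y : EuclideanSpace ℝ ι} (hy : y ≠ 0) :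
    ‖kerReg ε t y‖ ≤ ‖y‖ ^ (-(Fintype.card ι - 1 : ℝ)) := by
  have hn : 0 < ‖y‖ := norm_pos_iff.2 hy
  have h1 : (‖y‖ ^ 2 + ε) ^ (-(Fintype.card ι / 2 : ℝ)) ≤ ‖y‖ ^ (-(Fintype.card ι : ℝ)) := by
    have : ‖y‖ ^ (-(Fintype.card ι : ℝ)) = (‖y‖ ^ 2) ^ (-(Fintype.card ι / 2 : ℝ)) := by
      rw [← Real.rpow_natCast ‖y‖ 2, ← Real.rpow_mul hn.le]
      congr 1
      push_cast
      ring
    rw [this]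
    exact Real.rpow_le_rpow_of_nonpos (by positivity) (by linarith)
      (neg_nonpos.2 (by positivity))
  calc ‖kerReg ε t y‖ = |y t| * (‖y‖ ^ 2 + ε) ^ (-(Fintype.card ι / 2 : ℝ)) := by
        rw [kerReg, norm_mul, Real.norm_eq_abs, Real.norm_of_nonneg (by positivity)]
    _ ≤ ‖y‖ * ‖y‖ ^ (-(Fintype.card ι : ℝ)) := by
        gcongr
        exact abs_coord_le t y
    _ = _ := by
        nth_rewrite 1 [← Real.rpow_one ‖y‖]
        rw [← Real.rpow_add hn]
        congr 1
        ring

theorem measurable_kerReg (ε : ℝ) (t : ι) : Measurable (kerReg ε t) := by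
  unfold kerReg
  fun_prop

theorem locallyIntegrable_ker [Nonempty ι] (t : ι) :
    LocallyIntegrable (ker t : EuclideanSpace ℝ ι → ℝ) := by
  refine locallyIntegrable_of_norm_le_rpow (C := 1) (α := Fintype.card ι - 1) ?_ ?_ ?_
    (measurable_kerReg 0 t).aestronglyMeasurable
  · simpa using Nat.one_le_iff_ne_zero.2 Fintype.card_ne_zero
  · simp
  · filter_upwards [measure_eq_zero_iff_ae_notMem.1 (measure_singleton (0 : EuclideanSpace ℝ ι))]
      with y hy
    rw [one_mul]
    exact norm_kerReg_le le_rfl t (by simpa using hy)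

/-- The divergence of the regularized kernel, an approximate identity up to a constant. -/
noncomputable def kerDiv (ε : ℝ) (y : EuclideanSpace ℝ ι) : ℝ :=
  Fintype.card ι * ε * (‖y‖ ^ 2 + ε) ^ (-(Fintype.card ι / 2 : ℝ) - 1)

/-- With `q = |y|² + ε`, the exponent `N/2` makes `N q^(-N/2) - N |y|² q^(-N/2-1)` collapse to `N ε
q^(-N/2-1)`; for `ε = 0` the field would be divergence-free off the origin. -/
theorem sum_fderiv_kerReg {ε : ℝ} {y : EuclideanSpace ℝ ι} (h : 0 < ‖y‖ ^ 2 + ε) :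
    ∑ t, fderiv ℝ (kerReg ε t) y (EuclideanSpace.single t 1) = kerDiv ε y := by
  simp_rw [fderiv_kerReg _ _ h]
  have hn : ∑ t, y t * y t = ‖y‖ ^ 2 := by
    rw [EuclideanSpace.norm_sq_eq]
    exact Finset.sum_congr rfl fun t _ => by rw [Real.norm_eq_abs, sq_abs, sq]
  have hs : ∑ t, (Fintype.card ι * y t * y t *
      (‖y‖ ^ 2 + ε) ^ (-(Fintype.card ι / 2 : ℝ) - 1)) =
      Fintype.card ι * ‖y‖ ^ 2 * (‖y‖ ^ 2 + ε) ^ (-(Fintype.card ι / 2 : ℝ) - 1) := by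
    rw [← hn, Finset.mul_sum, Finset.sum_mul]
    exact Finset.sum_congr rfl fun t _ => by ring
  have hq : (‖y‖ ^ 2 + ε) ^ (-(Fintype.card ι / 2 : ℝ)) =
      (‖y‖ ^ 2 + ε) ^ (-(Fintype.card ι / 2 : ℝ) - 1) * (‖y‖ ^ 2 + ε) := by
    nth_rewrite 3 [← Real.rpow_one (‖y‖ ^ 2 + ε)]
    rw [← Real.rpow_add h]
    simp
  rw [Finset.sum_sub_distrib, hs]
  simp only [if_true, Finset.sum_const, Finset.card_univ, nsmul_eq_mul, kerDiv]
  rw [hq]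
  ring

/-- This is the factorization of the Laplacian, in terms of the kernel. The field `kerReg` is a
gradient, so its Jacobian is symmetric and the mixed terms cancel; the terms with `A_t²` add up to
zero over each block; only the divergence remains. -/
theorem CRSystem.sum_fderiv_kerReg_smul (C : CRSystem ι W) {ε : ℝ} {y : EuclideanSpace ℝ ι}
    (h : 0 < ‖y‖ ^ 2 + ε) (w : W) :
    ∑ t, ((fderiv ℝ (kerReg ε t) y (EuclideanSpace.single t 1) • w -
        C.coeff t (fderiv ℝ (kerReg ε t) y (EuclideanSpace.single (C.lead t) 1) • w)) +
      (fderiv ℝ (kerReg ε (C.lead t)) y (EuclideanSpace.single t 1) • C.coeff t w -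
        C.coeff t (fderiv ℝ (kerReg ε (C.lead t)) y (EuclideanSpace.single (C.lead t) 1) •
          C.coeff t w))) = kerDiv ε y • w := by
  have hsymm : ∀ s t, fderiv ℝ (kerReg ε s) y (EuclideanSpace.single t 1) =
      fderiv ℝ (kerReg ε t) y (EuclideanSpace.single s 1) := fun s t => by
    rw [fderiv_kerReg _ _ h, fderiv_kerReg _ _ h]
    simp only [eq_comm (a := s) (b := t)]
    ring
  set k : ι → ℝ := fun s => fderiv ℝ (kerReg ε s) y (EuclideanSpace.single s 1) with hk
  have hterm : ∀ t, ((fderiv ℝ (kerReg ε t) y (EuclideanSpace.single t 1) • w -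
        C.coeff t (fderiv ℝ (kerReg ε t) y (EuclideanSpace.single (C.lead t) 1) • w)) +
      (fderiv ℝ (kerReg ε (C.lead t)) y (EuclideanSpace.single t 1) • C.coeff t w -
        C.coeff t (fderiv ℝ (kerReg ε (C.lead t)) y (EuclideanSpace.single (C.lead t) 1) •
          C.coeff t w))) = k t • w - k (C.lead t) • C.coeff t (C.coeff t w) := fun t => by
    rw [hsymm t (C.lead t), map_smul, map_smul]
    abel
  have hz : ∑ t, k (C.lead t) • C.coeff t (C.coeff t w) = 0 := by
    rw [← Finset.sum_fiberwise Finset.univ C.lead]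
    refine Finset.sum_eq_zero fun b _ => ?_
    have : ∀ t ∈ Finset.univ.filter (fun t => C.lead t = b),
        k (C.lead t) • C.coeff t (C.coeff t w) = k b • C.coeff t (C.coeff t w) := fun t ht => by
      rw [(Finset.mem_filter.1 ht).2]
    rw [Finset.sum_congr rfl this, ← Finset.smul_sum, C.sum_sq, smul_zero]
  simp_rw [hterm]
  rw [Finset.sum_sub_distrib, hz, sub_zero, ← Finset.sum_smul, hk, sum_fderiv_kerReg h]

theorem CRSystem.dbar_coeff_comp (C : CRSystem ι W) (s t : ι) {φ : EuclideanSpace ℝ ι → W}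
    {x : EuclideanSpace ℝ ι} (hd : DifferentiableAt ℝ φ x) :
    C.dbar t (fun y => C.coeff s (φ y)) x = C.coeff s (C.dbar t φ x) := by
  have : fderiv ℝ (fun y => C.coeff s (φ y)) x = (C.coeff s).comp (fderiv ℝ φ x) :=
    ((C.coeff s).hasFDerivAt.comp x hd.hasFDerivAt).fderiv
  simp [CRSystem.dbar, this, C.comm t s]

/-- For `ε > 0` the kernel is smooth on the whole space, so integration by parts moves the operator
onto it and the factorization applies under the integral. -/
theorem CRSystem.integral_kerReg_dbar [Nonempty ι] (C : CRSystem ι W) {ε : ℝ} (hε : 0 < ε)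
    {φ : EuclideanSpace ℝ ι → W} (hd : Differentiable ℝ φ) (hc : HasCompactSupport φ)
    (hcont : ∀ t, Continuous (C.dbar t φ)) (x : EuclideanSpace ℝ ι) :
    ∑ t, ((∫ y, kerReg ε t y • C.dbar t φ (x - y)) +
      ∫ y, kerReg ε (C.lead t) y • C.coeff t (C.dbar t φ (x - y))) =
      ∫ y, kerDiv ε y • φ (x - y) := by
  have hq : ∀ y : EuclideanSpace ℝ ι, 0 < ‖y‖ ^ 2 + ε := fun y => by positivity
  have hk : ∀ t : ι, ContDiff ℝ 1 (kerReg ε t) := fun t =>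
    contDiff_iff_contDiffAt.2 fun y => (contDiffAt_kerReg t (hq y)).of_le (by simp)
  have hdA : ∀ t, Differentiable ℝ fun y => C.coeff t (φ y) := fun t =>
    (C.coeff t).differentiable.comp hd
  have hcA : ∀ t, HasCompactSupport fun y => C.coeff t (φ y) := fun t =>
    hc.comp_left (map_zero (C.coeff t))
  have hA : ∀ t, C.dbar t (fun y => C.coeff t (φ y)) = fun y => C.coeff t (C.dbar t φ y) :=
    fun t => funext fun y => C.dbar_coeff_comp t t (hd y)
  have hcs : HasCompactSupport fun y => φ (x - y) :=
    hc.comp_homeomorph (Homeomorph.subLeft x)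
  have h1 := fun t => C.integral_smul_dbar t (hk t) hd hc (hcont t) x
  have h2 := fun t => C.integral_smul_dbar t (hk (C.lead t)) (hdA t) (hcA t)
    (by rw [hA]; exact (C.coeff t).continuous.comp (hcont t)) x
  simp_rw [hA] at h2
  simp_rw [h1, h2]
  have hi : ∀ (s : ι) (v : EuclideanSpace ℝ ι) (B : W →L[ℝ] W),
      Integrable fun y => fderiv ℝ (kerReg ε s) y v • B (φ (x - y)) := fun s v B => by
    have hc1 : Continuous fun y => fderiv ℝ (kerReg ε s) y v :=
      ((hk s).continuous_fderiv one_ne_zero).clm_apply continuous_const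
    have hc2 : Continuous fun y => B (φ (x - y)) :=
      B.continuous.comp (hd.continuous.comp (continuous_const.sub continuous_id))
    exact (hc1.smul hc2).integrable_of_hasCompactSupport
      (HasCompactSupport.smul_left (hcs.comp_left (map_zero B)))
  have hi' : ∀ (s t : ι) (v : EuclideanSpace ℝ ι) (B : W →L[ℝ] W),
      Integrable fun y => C.coeff t (fderiv ℝ (kerReg ε s) y v • B (φ (x - y))) :=
    fun s t v B => (C.coeff t).integrable_comp (hi s v B)
  have hi1 : ∀ t, Integrable fun y => fderiv ℝ (kerReg ε t) y (EuclideanSpace.single t 1) •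
      φ (x - y) - C.coeff t (fderiv ℝ (kerReg ε t) y
        (EuclideanSpace.single (C.lead t) 1) • φ (x - y)) := fun t =>
    (hi t _ (ContinuousLinearMap.id ℝ W)).sub (hi' t t _ (ContinuousLinearMap.id ℝ W))
  have hi2 : ∀ t, Integrable fun y => fderiv ℝ (kerReg ε (C.lead t)) y
      (EuclideanSpace.single t 1) • C.coeff t (φ (x - y)) -
      C.coeff t (fderiv ℝ (kerReg ε (C.lead t)) y
        (EuclideanSpace.single (C.lead t) 1) • C.coeff t (φ (x - y))) := fun t =>
    (hi _ _ (C.coeff t)).sub (hi' _ t _ (C.coeff t))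
  simp_rw [← integral_add (hi1 _) (hi2 _)]
  refine (integral_finsetSum _ fun t _ => (hi1 t).add (hi2 t)).symm.trans ?_
  exact integral_congr_ae
    (Eventually.of_forall fun y => C.sum_fderiv_kerReg_smul (hq y) (φ (x - y)))

/-- The total mass of the approximate identity `kerDiv`. -/
noncomputable def kerMass (ι : Type*) [Fintype ι] : ℝ :=
  ∫ y : EuclideanSpace ℝ ι, kerDiv 1 y

theorem integrable_kerDiv_one : Integrable (kerDiv 1 : EuclideanSpace ℝ ι → ℝ) := by
  have := integrable_rpow_neg_one_add_norm_sq (E := EuclideanSpace ℝ ι) (μ := volume)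
    (r := Fintype.card ι + 2) (by simp)
  refine (this.const_mul (Fintype.card ι : ℝ)).congr (Eventually.of_forall fun y => ?_)
  simp only [kerDiv, mul_one]
  rw [add_comm (1 : ℝ)]
  congr 2
  ring

theorem kerMass_pos [Nonempty ι] : 0 < kerMass ι := by
  have hN : (0 : ℝ) < Fintype.card ι := Nat.cast_pos.2 Fintype.card_pos
  have hpos : ∀ y : EuclideanSpace ℝ ι, 0 < kerDiv 1 y := fun y => by
    unfold kerDiv
    positivity
  refine (integral_pos_iff_support_of_nonneg (fun y => (hpos y).le) integrable_kerDiv_one).2 ?_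
  rw [Function.support_eq_univ fun y => (hpos y).ne']
  exact Measure.measure_univ_pos.2 (NeZero.ne _)

/-- Substitution `y = δ z`: `kerDiv (δ ^ 2)` is the mass-preserving dilation of `kerDiv 1` by `δ`,
hence an approximate identity up to the factor `kerMass`. -/
theorem integral_kerDiv_smul {δ : ℝ} (hδ : 0 < δ) (g : EuclideanSpace ℝ ι → W) :
    ∫ y, kerDiv (δ ^ 2) y • g y = ∫ z, kerDiv 1 z • g (δ • z) := by
  have h := Measure.integral_comp_smul (volume : Measure (EuclideanSpace ℝ ι))
    (fun y => kerDiv (δ ^ 2) y • g y) δ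
  have hN : 0 < δ ^ Fintype.card ι := by positivity
  rw [finrank_euclideanSpace, abs_of_pos (inv_pos.2 hN), eq_inv_smul_iff₀ hN.ne',
    ← integral_smul] at h
  rw [← h]
  refine integral_congr_ae (Eventually.of_forall fun z => ?_)
  simp only [smul_smul]
  congr 1
  have : ‖δ • z‖ ^ 2 + δ ^ 2 = δ ^ 2 * (‖z‖ ^ 2 + 1) := by
    rw [norm_smul, Real.norm_of_nonneg hδ.le]
    ring
  simp only [kerDiv, this, mul_one]
  rw [Real.mul_rpow (by positivity) (by positivity)]
  have h2 : (δ ^ 2) ^ (-(Fintype.card ι / 2 : ℝ) - 1) = (δ ^ Fintype.card ι)⁻¹ * (δ ^ 2)⁻¹ := by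
    rw [← Real.rpow_natCast δ 2, ← Real.rpow_mul hδ.le, ← Real.rpow_natCast δ (Fintype.card ι),
      ← Real.rpow_neg hδ.le, ← Real.rpow_neg hδ.le, ← Real.rpow_add hδ]
    congr 1
    push_cast
    ring
  rw [h2]
  field_simp

/-- The potential operator inverting the Cauchy–Riemann operator, up to the factor `kerMass`. -/
noncomputable def CRSystem.pot (C : CRSystem ι W) (h : ι → EuclideanSpace ℝ ι → W)
    (x : EuclideanSpace ℝ ι) : W :=
  ∑ t, ((∫ y, ker t y • h t (x - y)) + ∫ y, ker (C.lead t) y • C.coeff t (h t (x - y)))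

theorem tendsto_integral_kerReg [Nonempty ι] (t : ι) {h : EuclideanSpace ℝ ι → W}
    (hh : Continuous h) (hc : HasCompactSupport h) (x : EuclideanSpace ℝ ι) :
    Tendsto (fun δ : ℝ => ∫ y, kerReg (δ ^ 2) t y • h (x - y)) (𝓝[>] 0)
      (𝓝 (∫ y, ker t y • h (x - y))) := by
  have hcs : HasCompactSupport fun y => h (x - y) := hc.comp_homeomorph (Homeomorph.subLeft x)
  have hcont : Continuous fun y => h (x - y) := hh.comp (continuous_const.sub continuous_id)
  have hne : ∀ᵐ y : EuclideanSpace ℝ ι, y ≠ 0 := by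
    filter_upwards [measure_eq_zero_iff_ae_notMem.1 (measure_singleton (0 : EuclideanSpace ℝ ι))]
      with y hy using by simpa using hy
  have hloc : LocallyIntegrable
      fun y : EuclideanSpace ℝ ι => ‖y‖ ^ (-(Fintype.card ι - 1 : ℝ)) := by
    refine locallyIntegrable_of_norm_le_rpow (C := 1) (α := Fintype.card ι - 1) ?_ ?_ ?_
      (Measurable.aestronglyMeasurable (by fun_prop))
    · simpa using Nat.one_le_iff_ne_zero.2 Fintype.card_ne_zero
    · simp
    · refine Eventually.of_forall fun y => ?_
      rw [one_mul, Real.norm_of_nonneg (by positivity)]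
  refine tendsto_integral_filter_of_dominated_convergence
    (fun y => ‖‖y‖ ^ (-(Fintype.card ι - 1 : ℝ)) • h (x - y)‖) ?_ ?_ ?_ ?_
  · exact Eventually.of_forall fun δ =>
      (measurable_kerReg _ t).aestronglyMeasurable.smul hcont.aestronglyMeasurable
  · refine Eventually.of_forall fun δ => ?_
    filter_upwards [hne] with y hy
    rw [norm_smul, norm_smul]
    gcongr
    exact (norm_kerReg_le (sq_nonneg δ) t hy).trans (le_abs_self _)
  · exact (hloc.integrable_smul_right_of_hasCompactSupport hcont hcs).norm
  · filter_upwards [hne] with y hy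
    refine Tendsto.smul_const ?_ _
    have hq : ‖y‖ ^ 2 + (0 : ℝ) ^ 2 ≠ 0 := by
      have := norm_pos_iff.2 hy
      positivity
    have : ContinuousAt (fun δ : ℝ => kerReg (δ ^ 2) t y) 0 := by
      unfold kerReg
      exact continuousAt_const.mul
        (ContinuousAt.rpow_const (by fun_prop) (Or.inl hq))
    have h2 := this.tendsto.mono_left (nhdsWithin_le_nhds (s := Ioi 0))
    simpa [ker] using h2

/-- **Cauchy–Pompeiu formula**: a compactly supported differentiable function is the potential of
its image under the Cauchy–Riemann operator. -/
theorem CRSystem.pot_dbar [Nonempty ι] [CompleteSpace W] (C : CRSystem ι W)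
    {φ : EuclideanSpace ℝ ι → W} (hd : Differentiable ℝ φ) (hc : HasCompactSupport φ)
    (hcont : ∀ t, Continuous (C.dbar t φ)) (x : EuclideanSpace ℝ ι) :
    C.pot (fun t => C.dbar t φ) x = kerMass ι • φ x := by
  have hcD := fun t => C.hasCompactSupport_dbar t hc
  have h1 : Tendsto (fun δ : ℝ => ∑ t, ((∫ y, kerReg (δ ^ 2) t y • C.dbar t φ (x - y)) +
      ∫ y, kerReg (δ ^ 2) (C.lead t) y • C.coeff t (C.dbar t φ (x - y)))) (𝓝[>] 0)
      (𝓝 (C.pot (fun t => C.dbar t φ) x)) := by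
    refine tendsto_finsetSum _ fun t _ => (tendsto_integral_kerReg t (hcont t) (hcD t) x).add ?_
    exact tendsto_integral_kerReg (C.lead t) (h := fun y => C.coeff t (C.dbar t φ y))
      ((C.coeff t).continuous.comp (hcont t)) ((hcD t).comp_left (map_zero _)) x
  obtain ⟨M, hM⟩ := hd.continuous.bounded_above_of_compact_support hc
  have h2 : Tendsto (fun δ : ℝ => ∫ z, kerDiv 1 z • φ (x - δ • z)) (𝓝[>] 0)
      (𝓝 (∫ z : EuclideanSpace ℝ ι, kerDiv 1 z • φ x)) := by
    refine tendsto_integral_filter_of_dominated_convergence (fun z => ‖kerDiv 1 z‖ * M) ?_ ?_ ?_ ?_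
    · refine Eventually.of_forall fun δ => ?_
      exact integrable_kerDiv_one.aestronglyMeasurable.smul
        (hd.continuous.comp (by fun_prop : Continuous fun z : EuclideanSpace ℝ ι =>
          x - δ • z)).aestronglyMeasurable
    · refine Eventually.of_forall fun δ => Eventually.of_forall fun z => ?_
      rw [norm_smul]
      gcongr
      exact hM _
    · exact integrable_kerDiv_one.norm.mul_const M
    · refine Eventually.of_forall fun z => Tendsto.const_smul ?_ _
      have : Continuous fun δ : ℝ => φ (x - δ • z) := hd.continuous.comp (by fun_prop)
      have h3 := (this.tendsto 0).mono_left (nhdsWithin_le_nhds (s := Ioi 0))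
      simpa using h3
  rw [integral_smul_const] at h2
  -- For each `δ > 0` the two families coincide, by `integral_kerReg_dbar` with `ε = δ²`.
  refine tendsto_nhds_unique h1 (h2.congr' ?_)
  filter_upwards [self_mem_nhdsWithin] with δ hδ
  have hδ' : (0 : ℝ) < δ := hδ
  rw [C.integral_kerReg_dbar (by positivity : 0 < δ ^ 2) hd hc hcont x,
    integral_kerDiv_smul hδ' fun y => φ (x - y)]

/-! ### Solutions and their representation by cutoffs. -/

/-- `f` is differentiable and annihilated by the Cauchy–Riemann operator at the points of `U`. -/
def CRSystem.IsSolOn (C : CRSystem ι W) (f : EuclideanSpace ℝ ι → W)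
    (U : Set (EuclideanSpace ℝ ι)) : Prop :=
  ∀ x ∈ U, DifferentiableAt ℝ f x ∧ ∀ t, C.dbar t f x = 0

theorem CRSystem.dbar_congr (C : CRSystem ι W) (t : ι) {f g : EuclideanSpace ℝ ι → W}
    {x : EuclideanSpace ℝ ι} (h : f =ᶠ[𝓝 x] g) : C.dbar t f x = C.dbar t g x := by
  simp only [CRSystem.dbar, h.fderiv_eq]

theorem CRSystem.dbar_sub (C : CRSystem ι W) (t : ι) {f g : EuclideanSpace ℝ ι → W}
    {x : EuclideanSpace ℝ ι} (hf : DifferentiableAt ℝ f x) (hg : DifferentiableAt ℝ g x) :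
    C.dbar t (fun y => f y - g y) x = C.dbar t f x - C.dbar t g x := by
  simp only [CRSystem.dbar, fderiv_fun_sub hf hg, sub_apply, map_sub]
  abel

theorem CRSystem.IsSolOn.sub {C : CRSystem ι W} {f g : EuclideanSpace ℝ ι → W}
    {U : Set (EuclideanSpace ℝ ι)} (hf : C.IsSolOn f U) (hg : C.IsSolOn g U) :
    C.IsSolOn (fun y => f y - g y) U := fun x hx =>
  ⟨(hf x hx).1.sub (hg x hx).1, fun t => by
    rw [C.dbar_sub t (hf x hx).1 (hg x hx).1, (hf x hx).2, (hg x hx).2, sub_zero]⟩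

theorem CRSystem.IsSolOn.mono {C : CRSystem ι W} {f : EuclideanSpace ℝ ι → W}
    {U U' : Set (EuclideanSpace ℝ ι)} (hf : C.IsSolOn f U) (h : U' ⊆ U) : C.IsSolOn f U' :=
  fun x hx => hf x (h hx)

/-- The commutator `d''(χ f) - χ d''f` of the Cauchy–Riemann operator with multiplication by a
scalar function. -/
noncomputable def CRSystem.cut (C : CRSystem ι W) (χ : EuclideanSpace ℝ ι → ℝ)
    (f : EuclideanSpace ℝ ι → W) (t : ι) (y : EuclideanSpace ℝ ι) : W :=
  fderiv ℝ χ y (EuclideanSpace.single t 1) • f y -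
    C.coeff t (fderiv ℝ χ y (EuclideanSpace.single (C.lead t) 1) • f y)

theorem CRSystem.dbar_smul (C : CRSystem ι W) (t : ι) {χ : EuclideanSpace ℝ ι → ℝ}
    {f : EuclideanSpace ℝ ι → W} {x : EuclideanSpace ℝ ι} (hχ : DifferentiableAt ℝ χ x)
    (hf : DifferentiableAt ℝ f x) :
    C.dbar t (fun y => χ y • f y) x = χ x • C.dbar t f x + C.cut χ f t x := by
  simp only [CRSystem.dbar, CRSystem.cut, fderiv_fun_smul hχ hf]
  simp
  module

theorem CRSystem.cut_eq_zero (C : CRSystem ι W) {χ : EuclideanSpace ℝ ι → ℝ}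
    (f : EuclideanSpace ℝ ι → W) (t : ι) {y : EuclideanSpace ℝ ι} (h : fderiv ℝ χ y = 0) :
    C.cut χ f t y = 0 := by
  simp [CRSystem.cut, h]

section Cutoff

variable (C : CRSystem ι W) {U : Set (EuclideanSpace ℝ ι)} {f : EuclideanSpace ℝ ι → W}
  {χ : EuclideanSpace ℝ ι → ℝ}

theorem CRSystem.hasCompactSupport_cut (f : EuclideanSpace ℝ ι → W)
    (hχc : HasCompactSupport χ) (t : ι) : HasCompactSupport (C.cut χ f t) := by
  refine hχc.mono' fun y hy => ?_
  contrapose! hy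
  rw [Function.notMem_support]
  exact C.cut_eq_zero f t
    (image_eq_zero_of_notMem_tsupport fun h => hy (tsupport_fderiv_subset ℝ h))

/-- No derivative of `f` enters `cut`, so a solution that is merely differentiable still gives a
continuous density, as the Cauchy–Pompeiu formula demands. -/
theorem CRSystem.continuous_cut (hf : ∀ x ∈ U, ContinuousAt f x) (hχ : ContDiff ℝ ∞ χ)
    (hχU : tsupport χ ⊆ U) (t : ι) : Continuous (C.cut χ f t) := by
  refine continuous_iff_continuousAt.2 fun x => ?_
  by_cases hx : x ∈ tsupport χ
  · have hk : ∀ v, ContinuousAt (fun y => fderiv ℝ χ y v) x := fun v =>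
      ((hχ.continuous_fderiv (by simp)).clm_apply continuous_const).continuousAt
    exact ((hk _).smul (hf x (hχU hx))).sub
      ((C.coeff t).continuous.continuousAt.comp ((hk _).smul (hf x (hχU hx))))
  · refine ContinuousAt.congr (f := fun _ => 0) continuousAt_const ?_
    have : (tsupport χ)ᶜ ∈ 𝓝 x := (isClosed_tsupport χ).isOpen_compl.mem_nhds hx
    filter_upwards [this] with y hy
    exact (C.cut_eq_zero f t
      (image_eq_zero_of_notMem_tsupport fun h => hy (tsupport_fderiv_subset ℝ h))).symm

/-- Representation of a solution, multiplied by a cutoff function, by the potential operator. -/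
theorem CRSystem.pot_cut [Nonempty ι] [CompleteSpace W] (hf : C.IsSolOn f U)
    (hχ : ContDiff ℝ ∞ χ) (hχc : HasCompactSupport χ) (hχU : tsupport χ ⊆ U)
    (x : EuclideanSpace ℝ ι) : C.pot (C.cut χ f) x = kerMass ι • χ x • f x := by
  have hχd : Differentiable ℝ χ := hχ.differentiable (by simp)
  have hzero : ∀ x ∉ tsupport χ, (fun y => χ y • f y) =ᶠ[𝓝 x] fun _ => 0 := fun x hx => by
    filter_upwards [(isClosed_tsupport χ).isOpen_compl.mem_nhds hx] with y hy
    rw [image_eq_zero_of_notMem_tsupport hy, zero_smul]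
  have hd : Differentiable ℝ fun y => χ y • f y := fun x => by
    by_cases hx : x ∈ tsupport χ
    · exact (hχd x).smul (hf x (hχU hx)).1
    · exact (differentiableAt_const 0).congr_of_eventuallyEq (hzero x hx)
  have hD : ∀ t, C.dbar t (fun y => χ y • f y) = C.cut χ f t := fun t => funext fun x => by
    by_cases hx : x ∈ tsupport χ
    · rw [C.dbar_smul t (hχd x) (hf x (hχU hx)).1, (hf x (hχU hx)).2, smul_zero, zero_add]
    · rw [C.dbar_congr t (hzero x hx), C.cut_eq_zero f t
        (image_eq_zero_of_notMem_tsupport fun h => hx (tsupport_fderiv_subset ℝ h))]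
      simp [CRSystem.dbar]
  have := C.pot_dbar hd hχc.smul_right (fun t => by
    rw [hD]
    exact C.continuous_cut (fun x hx => (hf x hx).1.continuousAt) hχ hχU t) x
  simp_rw [hD] at this
  exact this

end Cutoff

/-! ### Smoothness and analyticity of potentials. -/

/-- The convolution with the kernel is smooth off the support of the density. -/
theorem contDiffAt_integral_ker [FiniteDimensional ℝ W] (t : ι)
    {h : EuclideanSpace ℝ ι → W} (hh : Continuous h) (hc : HasCompactSupport h)
    {x₀ : EuclideanSpace ℝ ι} (hx : x₀ ∉ tsupport h) :
    ContDiffAt ℝ ∞ (fun x => ∫ y, ker t y • h (x - y)) x₀ := by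
  obtain ⟨r, hr, hball⟩ := Metric.mem_nhds_iff.1
    ((isClosed_tsupport h).isOpen_compl.mem_nhds hx)
  obtain ⟨R, hR0, hR⟩ := (IsCompact.isBounded hc).subset_closedBall_lt 0 x₀
  -- For `x` within `r/2` of `x₀` and `x - y` in the support, `r/2 ≤ |y| ≤ R + r`. There `b₁ - b₂ =
  -- 1`, while it is `0` on `|y| < r/4`; so the kernel may be replaced by the smooth, compactly
  -- supported `κ`.
  let b₁ : ContDiffBump (0 : EuclideanSpace ℝ ι) := ⟨R + r, R + r + 1, by positivity, by linarith⟩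
  let b₂ : ContDiffBump (0 : EuclideanSpace ℝ ι) := ⟨r / 4, r / 2, by positivity, by linarith⟩
  let κ : EuclideanSpace ℝ ι → ℝ := fun y => (b₁ y - b₂ y) * ker t y
  have hκc : HasCompactSupport κ := (b₁.hasCompactSupport.sub b₂.hasCompactSupport).mul_right
  have hκ : ContDiff ℝ ∞ κ := contDiff_iff_contDiffAt.2 fun y => by
    by_cases hy : y = 0
    · refine (contDiffAt_const (c := (0 : ℝ))).congr_of_eventuallyEq ?_
      filter_upwards [Metric.ball_mem_nhds y (by positivity : 0 < r / 4)] with z hz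
      rw [hy, mem_ball_zero_iff] at hz
      have h1 : b₁ z = 1 := b₁.one_of_mem_closedBall (by
        rw [mem_closedBall_zero_iff]
        change ‖z‖ ≤ R + r
        linarith)
      have h2 : b₂ z = 1 := b₂.one_of_mem_closedBall (by
        rw [mem_closedBall_zero_iff]
        exact hz.le)
      simp [κ, h1, h2]
    · refine (b₁.contDiffAt.sub b₂.contDiffAt).mul (contDiffAt_kerReg t ?_)
      have := norm_pos_iff.2 hy
      positivity
  have hconv : ContDiff ℝ ∞ (κ ⋆[ContinuousLinearMap.lsmul ℝ ℝ] h) :=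
    hκc.contDiff_convolution_left _ hκ hh.locallyIntegrable
  refine hconv.contDiffAt.congr_of_eventuallyEq ?_
  filter_upwards [Metric.ball_mem_nhds x₀ (by positivity : 0 < r / 2)] with x hx
  rw [convolution_def]
  refine integral_congr_ae (Eventually.of_forall fun y => ?_)
  by_cases hy : x - y ∈ tsupport h
  · have h3 : ‖x - y - x₀‖ ≤ R := by
      simpa [dist_eq_norm] using hR hy
    have h4 : r ≤ ‖x - y - x₀‖ := by
      by_contra! hlt
      exact hball (by rwa [Metric.mem_ball, dist_eq_norm]) hy
    rw [Metric.mem_ball, dist_eq_norm] at hx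
    have h5 : ‖y‖ ≤ ‖x - x₀‖ + ‖x - y - x₀‖ := by
      have : y = (x - x₀) - (x - y - x₀) := by abel
      nth_rewrite 1 [this]
      exact norm_sub_le _ _
    have h6 : ‖x - y - x₀‖ ≤ ‖x - x₀‖ + ‖y‖ := by
      have : x - y - x₀ = (x - x₀) - y := by abel
      rw [this]
      exact norm_sub_le _ _
    have h1 : b₁ y = 1 := b₁.one_of_mem_closedBall (by
      rw [mem_closedBall_zero_iff]
      change ‖y‖ ≤ R + r
      linarith)
    have h2 : b₂ y = 0 := b₂.zero_of_le_dist (by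
      rw [dist_zero_right]
      change r / 2 ≤ ‖y‖
      linarith)
    simp [κ, h1, h2]
  · simp [image_eq_zero_of_notMem_tsupport hy]

theorem CRSystem.contDiffAt_pot [FiniteDimensional ℝ W] (C : CRSystem ι W)
    {h : ι → EuclideanSpace ℝ ι → W} (hh : ∀ t, Continuous (h t))
    (hc : ∀ t, HasCompactSupport (h t)) {x₀ : EuclideanSpace ℝ ι}
    (hx : ∀ t, x₀ ∉ tsupport (h t)) : ContDiffAt ℝ ∞ (C.pot h) x₀ := by
  refine ContDiffAt.sum fun t _ => (contDiffAt_integral_ker t (hh t) (hc t) (hx t)).add ?_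
  refine contDiffAt_integral_ker (C.lead t) (h := fun y => C.coeff t (h t y))
    ((C.coeff t).continuous.comp (hh t)) ((hc t).comp_left (map_zero _)) fun hmem => hx t ?_
  exact tsupport_comp_subset (map_zero (C.coeff t)) _ hmem

/-- Near each point of an open set, a solution is the potential of a continuous compactly supported
density vanishing on a given ball. -/
theorem CRSystem.IsSolOn.exists_eq_pot [Nonempty ι] [CompleteSpace W] {C : CRSystem ι W}
    {U : Set (EuclideanSpace ℝ ι)} {f : EuclideanSpace ℝ ι → W} (hf : C.IsSolOn f U)
    {x₀ : EuclideanSpace ℝ ι} {r : ℝ} (hr : 0 < r) (hU : Metric.closedBall x₀ (2 * r) ⊆ U) :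
    ∃ h : ι → EuclideanSpace ℝ ι → W, (∀ t, Continuous (h t)) ∧
      (∀ t, HasCompactSupport (h t)) ∧ (∀ t, Disjoint (Metric.ball x₀ r) (tsupport (h t))) ∧
      EqOn f (C.pot h) (Metric.ball x₀ r) := by
  let b : ContDiffBump x₀ := ⟨r, 2 * r, hr, by linarith⟩
  -- Dividing by `kerMass` makes the potential equal to `f` itself where `b = 1`; there `dχ = 0`, so
  -- the density vanishes.
  let χ : EuclideanSpace ℝ ι → ℝ := fun y => (kerMass ι)⁻¹ * b y
  have hb : ContDiff ℝ ∞ (b : EuclideanSpace ℝ ι → ℝ) := b.contDiff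
  have hχ : ContDiff ℝ ∞ χ := contDiff_const.mul hb
  have hχc : HasCompactSupport χ := b.hasCompactSupport.mul_left
  have hχU : tsupport χ ⊆ U := by
    refine (closure_mono (Function.support_mul_subset_right _ _)).trans ?_
    exact b.tsupport_eq.subset.trans hU
  refine ⟨C.cut χ f, C.continuous_cut (fun x hx => (hf x hx).1.continuousAt) hχ hχU,
    C.hasCompactSupport_cut f hχc, fun t => ?_, fun x hx => ?_⟩
  · rw [← subset_compl_iff_disjoint_right]
    intro x hx
    rw [mem_compl_iff, notMem_tsupport_iff_eventuallyEq]
    filter_upwards [Metric.isOpen_ball.mem_nhds hx] with y hy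
    refine C.cut_eq_zero f t ?_
    have : χ =ᶠ[𝓝 y] fun _ => (kerMass ι)⁻¹ := by
      filter_upwards [Metric.isOpen_ball.mem_nhds hy] with z hz
      simp [χ, b.one_of_mem_closedBall (Metric.ball_subset_closedBall hz)]
    rw [this.fderiv_eq]
    simp
  · rw [C.pot_cut hf hχ hχc hχU x, smul_smul]
    simp [χ, b.one_of_mem_closedBall (Metric.ball_subset_closedBall hx), kerMass_pos.ne']

/-- Elliptic regularity: near each point a solution is the potential of a density supported away
from that point. -/
theorem CRSystem.IsSolOn.contDiffAt [Nonempty ι] [FiniteDimensional ℝ W] {C : CRSystem ι W}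
    {U : Set (EuclideanSpace ℝ ι)} {f : EuclideanSpace ℝ ι → W} (hf : C.IsSolOn f U)
    (hU : IsOpen U) {x₀ : EuclideanSpace ℝ ι} (hx : x₀ ∈ U) : ContDiffAt ℝ ∞ f x₀ := by
  have : CompleteSpace W := FiniteDimensional.complete ℝ W
  obtain ⟨r, hr, hball⟩ := Metric.nhds_basis_closedBall.mem_iff.1 (hU.mem_nhds hx)
  obtain ⟨h, hh, hc, hd, heq⟩ := hf.exists_eq_pot (x₀ := x₀) (r := r / 2) (by positivity)
    (by rwa [mul_div_cancel₀ _ two_ne_zero])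
  have hx₀ : x₀ ∈ Metric.ball x₀ (r / 2) := Metric.mem_ball_self (by positivity)
  exact (C.contDiffAt_pot hh hc fun t => disjoint_left.1 (hd t) hx₀).congr_of_eventuallyEq
    (heq.eventuallyEq_of_mem (Metric.isOpen_ball.mem_nhds hx₀))

/-- An integral over a compact set depends analytically on a complex parameter if the integrand
does. -/
theorem analyticAt_setIntegral {E : Type*} [TopologicalSpace E] [T2Space E]
    [MeasurableSpace E] [OpensMeasurableSpace E] [SecondCountableTopology E] {μ : Measure E}
    [IsFiniteMeasureOnCompacts μ] {K : Set E} (hK : IsCompact K) {G G' : ℂ → E → ℂ} {δ : ℝ}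
    (hδ : 0 < δ)
    (hG : ContinuousOn (fun p : ℂ × E => G p.1 p.2) (Metric.closedBall 0 δ ×ˢ K))
    (hG' : ContinuousOn (fun p : ℂ × E => G' p.1 p.2) (Metric.closedBall 0 δ ×ˢ K))
    (hd : ∀ z ∈ Metric.closedBall (0 : ℂ) δ, ∀ y ∈ K, HasDerivAt (fun z => G z y) (G' z y) z) :
    AnalyticAt ℂ (fun z => ∫ y in K, G z y ∂μ) 0 := by
  have hslice : ∀ {H : ℂ → E → ℂ},
      ContinuousOn (fun p : ℂ × E => H p.1 p.2) (Metric.closedBall 0 δ ×ˢ K) →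
      ∀ z ∈ Metric.closedBall (0 : ℂ) δ, ContinuousOn (H z) K := fun hH z hz =>
    hH.comp (f := fun y => (z, y)) (by fun_prop) fun y hy => ⟨hz, hy⟩
  obtain ⟨M, hM⟩ := ((isCompact_closedBall (0 : ℂ) δ).prod hK).exists_bound_of_continuousOn hG'
  refine DifferentiableOn.analyticAt (s := Metric.ball 0 δ) (fun z hz => ?_)
    (Metric.ball_mem_nhds 0 hδ)
  have hzn : Metric.closedBall (0 : ℂ) δ ∈ 𝓝 z :=
    mem_of_superset (Metric.isOpen_ball.mem_nhds hz) Metric.ball_subset_closedBall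
  have hz' := Metric.ball_subset_closedBall hz
  refine (hasDerivAt_integral_of_dominated_loc_of_deriv_le (μ := μ.restrict K)
    (bound := fun _ => M) (F' := G') hzn ?_ ?_ ?_ ?_ ?_ ?_).2.differentiableAt.differentiableWithinAt
  · filter_upwards [hzn] with w hw
    exact (hslice hG w hw).aestronglyMeasurable hK.measurableSet
  · exact (hslice hG z hz').integrableOn_compact hK
  · exact (hslice hG' z hz').aestronglyMeasurable hK.measurableSet
  · filter_upwards [ae_restrict_mem hK.measurableSet] with y hy w hw
    exact hM (w, y) ⟨hw, hy⟩
  · have : IsFiniteMeasure (μ.restrict K) :=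
      isFiniteMeasure_restrict.2 hK.measure_lt_top.ne
    exact integrable_const M
  · filter_upwards [ae_restrict_mem hK.measurableSet] with y hy w hw
    exact hd w hw y hy

/-- The convolution with the kernel is real analytic along lines off the support of the density. -/
theorem analyticAt_integral_ker_line (t : ι) {h : EuclideanSpace ℝ ι → ℝ} (hh : Continuous h)
    (hc : HasCompactSupport h) {x₀ : EuclideanSpace ℝ ι} (hx : x₀ ∉ tsupport h)
    (v : EuclideanSpace ℝ ι) :
    AnalyticAt ℝ (fun τ : ℝ => ∫ y, ker t y • h (x₀ + τ • v - y)) 0 := by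
  set K := tsupport h
  have hK : IsCompact K := hc
  -- `Q` and `l` extend `‖x₀ + τ v - y‖²` and the `t`-th coordinate of `x₀ + τ v - y` to complex
  -- `τ`; `G` is the integrand after the substitution that moves the parameter into the kernel.
  let Q : ℂ → EuclideanSpace ℝ ι → ℂ := fun z y =>
    ((‖x₀ - y‖ ^ 2 : ℝ) : ℂ) + z * ((2 * inner ℝ (x₀ - y) v : ℝ) : ℂ) + z ^ 2 * ((‖v‖ ^ 2 : ℝ) : ℂ)
  let Q' : ℂ → EuclideanSpace ℝ ι → ℂ := fun z y =>
    ((2 * inner ℝ (x₀ - y) v : ℝ) : ℂ) + 2 * z * ((‖v‖ ^ 2 : ℝ) : ℂ)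
  let l : ℂ → EuclideanSpace ℝ ι → ℂ := fun z y => (((x₀ - y) t : ℝ) : ℂ) + z * ((v t : ℝ) : ℂ)
  let c : ℂ := ((-(Fintype.card ι / 2 : ℝ) : ℝ) : ℂ)
  let G : ℂ → EuclideanSpace ℝ ι → ℂ := fun z y => l z y * Q z y ^ c * ((h y : ℝ) : ℂ)
  let G' : ℂ → EuclideanSpace ℝ ι → ℂ := fun z y =>
    (((v t : ℝ) : ℂ) * Q z y ^ c + l z y * (c * Q z y ^ (c - 1) * Q' z y)) * ((h y : ℝ) : ℂ)
  have hQc : Continuous fun p : ℂ × EuclideanSpace ℝ ι => Q p.1 p.2 := by fun_prop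
  have hQ'c : Continuous fun p : ℂ × EuclideanSpace ℝ ι => Q' p.1 p.2 := by fun_prop
  have hlc : Continuous fun p : ℂ × EuclideanSpace ℝ ι => l p.1 p.2 := by fun_prop
  have hhc : Continuous fun p : ℂ × EuclideanSpace ℝ ι => ((h p.2 : ℝ) : ℂ) := by fun_prop
  -- At `z = 0` the value of `Q` is positive since `x₀ ∉ K`; by compactness `Q` avoids the branch
  -- cut for all `y ∈ K` when `z` is small.
  have hev : ∀ᶠ z in 𝓝 (0 : ℂ), ∀ y ∈ K, Q z y ∈ Complex.slitPlane := by
    refine hK.eventually_forall_of_forall_eventually fun y hy => ?_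
    refine hQc.continuousAt.eventually_mem (Complex.isOpen_slitPlane.mem_nhds ?_)
    have hne : x₀ - y ≠ 0 := fun h0 => hx (by rwa [sub_eq_zero.1 h0])
    have : Q 0 y = ((‖x₀ - y‖ ^ 2 : ℝ) : ℂ) := by simp [Q]
    simp only [this, Complex.ofReal_mem_slitPlane]
    have := norm_pos_iff.2 hne
    positivity
  obtain ⟨δ, hδ, hslit⟩ := Metric.nhds_basis_closedBall.eventually_iff.1 hev
  have hpow : ∀ c : ℂ, ContinuousOn (fun p : ℂ × EuclideanSpace ℝ ι => Q p.1 p.2 ^ c)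
      (Metric.closedBall 0 δ ×ˢ K) := fun c =>
    hQc.continuousOn.cpow continuousOn_const fun p hp => hslit hp.1 p.2 hp.2
  have han : AnalyticAt ℂ (fun z => ∫ y in K, G z y) 0 := by
    refine analyticAt_setIntegral (G' := G') hK hδ ?_ ?_ fun z hz y hy => ?_
    · exact (hlc.continuousOn.mul (hpow c)).mul hhc.continuousOn
    · exact ((continuousOn_const.mul (hpow c)).add (hlc.continuousOn.mul
        ((continuousOn_const.mul (hpow (c - 1))).mul hQ'c.continuousOn))).mul hhc.continuousOn
    · have hl : HasDerivAt (fun z => l z y) ((v t : ℝ) : ℂ) z :=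
        (((hasDerivAt_id z).mul_const ((v t : ℝ) : ℂ)).const_add
          (((x₀ - y) t : ℝ) : ℂ)).congr_deriv (one_mul _)
      have hQ : HasDerivAt (fun z => Q z y) (Q' z y) z := by
        have h1 := ((hasDerivAt_id z).mul_const
          ((2 * inner ℝ (x₀ - y) v : ℝ) : ℂ)).const_add ((‖x₀ - y‖ ^ 2 : ℝ) : ℂ)
        have h2 := (hasDerivAt_pow 2 z).mul_const ((‖v‖ ^ 2 : ℝ) : ℂ)
        exact (h1.add h2).congr_deriv (by simp [Q'])
      exact (hl.mul (hQ.cpow_const (c := c) (hslit hz y hy))).mul_const ((h y : ℝ) : ℂ)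
  have hreal : ∀ τ : ℝ, ∫ y, ker t y • h (x₀ + τ • v - y) = (∫ y in K, G τ y).re := fun τ => by
    have h1 : ∀ y, G τ y = ((ker t (x₀ + τ • v - y) * h y : ℝ) : ℂ) := fun y => by
      have h2 : Q τ y = ((‖x₀ + τ • v - y‖ ^ 2 + 0 : ℝ) : ℂ) := by
        have : x₀ + τ • v - y = (x₀ - y) + τ • v := by abel
        rw [this, norm_add_sq_real, norm_smul, inner_smul_right, mul_pow, Real.norm_eq_abs, sq_abs]
        simp only [Q]
        push_cast
        ring
      have h3 : l τ y = (((x₀ + τ • v - y) t : ℝ) : ℂ) := by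
        simp only [l]
        simp
        ring
      simp only [G, h2, h3, ker, kerReg, c]
      rw [← Complex.ofReal_cpow (by positivity)]
      push_cast
      ring
    simp_rw [h1]
    rw [integral_complex_ofReal, Complex.ofReal_re, setIntegral_eq_integral_of_forall_compl_eq_zero
      fun y hy => by rw [image_eq_zero_of_notMem_tsupport hy, mul_zero]]
    rw [← integral_sub_left_eq_self _ volume (x₀ + τ • v)]
    simp
  simp_rw [hreal]
  have h4 : AnalyticAt ℝ (fun z => ∫ y in K, G z y) ((0 : ℝ) : ℂ) := by
    rw [Complex.ofReal_zero]
    exact han.restrictScalars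
  exact (Complex.reCLM.analyticAt _).comp (h4.comp (Complex.ofRealCLM.analyticAt 0))

theorem CRSystem.analyticAt_pot_line (C : CRSystem ι W) [Nonempty ι] [CompleteSpace W]
    {h : ι → EuclideanSpace ℝ ι → W}
    (hh : ∀ t, Continuous (h t)) (hc : ∀ t, HasCompactSupport (h t)) {x₀ : EuclideanSpace ℝ ι}
    (hx : ∀ t, x₀ ∉ tsupport (h t)) (v : EuclideanSpace ℝ ι) (Φ : W →L[ℝ] ℝ) :
    AnalyticAt ℝ (fun τ : ℝ => Φ (C.pot h (x₀ + τ • v))) 0 := by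
  have key : ∀ (t : ι) (g : EuclideanSpace ℝ ι → W), Continuous g → HasCompactSupport g →
      x₀ ∉ tsupport g →
      AnalyticAt ℝ (fun τ : ℝ => Φ (∫ y, ker t y • g (x₀ + τ • v - y))) 0 := by
    intro t g hg hgc hgx
    have h1 : ∀ τ : ℝ, Φ (∫ y, ker t y • g (x₀ + τ • v - y))
        = ∫ y, ker t y • Φ (g (x₀ + τ • v - y)) := fun τ => by
      rw [← Φ.integral_comp_comm]
      · simp
      · exact (locallyIntegrable_ker t).integrable_smul_right_of_hasCompactSupport
          (hg.comp (continuous_const.sub continuous_id))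
          (hgc.comp_homeomorph (Homeomorph.subLeft (x₀ + τ • v)))
    simp_rw [h1]
    exact analyticAt_integral_ker_line t (h := fun y => Φ (g y)) (Φ.continuous.comp hg)
      (hgc.comp_left (map_zero Φ)) (fun hmem => hgx (tsupport_comp_subset (map_zero Φ) _ hmem)) v
  simp only [CRSystem.pot, map_sum, map_add]
  refine Finset.analyticAt_fun_sum _ fun t _ => (key t _ (hh t) (hc t) (hx t)).add ?_
  exact key (C.lead t) (fun y => C.coeff t (h t y)) ((C.coeff t).continuous.comp (hh t))
    ((hc t).comp_left (map_zero _))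
    fun hmem => hx t (tsupport_comp_subset (map_zero (C.coeff t)) _ hmem)

/-! ### Unique continuation and Liouville's theorem. -/

/-- Unique continuation in a ball. -/
theorem CRSystem.IsSolOn.eqOn_zero_ball [Nonempty ι] [CompleteSpace W] {C : CRSystem ι W}
    {U : Set (EuclideanSpace ℝ ι)} {f : EuclideanSpace ℝ ι → W} (hf : C.IsSolOn f U)
    {x₀ x₁ : EuclideanSpace ℝ ι} {r : ℝ} (hr : 0 < r) (hU : Metric.closedBall x₀ (2 * r) ⊆ U)
    (hx₁ : x₁ ∈ Metric.ball x₀ r) (h₁ : f =ᶠ[𝓝 x₁] 0) : EqOn f 0 (Metric.ball x₀ r) := by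
  obtain ⟨h, hh, hc, hd, heq⟩ := hf.exists_eq_pot hr hU
  intro x hx
  refine (SeparatingDual.eq_zero_iff_forall_dual_eq_zero (R := ℝ) (f x)).2 fun Φ => ?_
  -- Along the segment from `x₁` to `x`, each real functional of the potential is an analytic
  -- function of one variable, zero near `τ = 0`.
  let γ : ℝ → EuclideanSpace ℝ ι := fun τ => x₁ + τ • (x - x₁)
  have hγ : ∀ τ ∈ Icc (0 : ℝ) 1, γ τ ∈ Metric.ball x₀ r := fun τ hτ => by
    have := (convex_ball x₀ r).add_smul_sub_mem hx₁ hx hτ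
    exact this
  have han : AnalyticOnNhd ℝ (fun τ => Φ (C.pot h (γ τ))) (Icc 0 1) := fun τ hτ => by
    have h1 := C.analyticAt_pot_line hh hc
      (fun t => disjoint_left.1 (hd t) (hγ τ hτ)) (x - x₁) Φ
    have h2 : (fun τ' => Φ (C.pot h (γ τ'))) =
        (fun σ : ℝ => Φ (C.pot h (γ τ + σ • (x - x₁)))) ∘ fun τ' => τ' - τ := by
      funext τ'
      simp only [Function.comp_apply, γ]
      congr 2
      module
    rw [h2]
    refine AnalyticAt.comp (by simpa using h1) ?_
    exact analyticAt_id.sub analyticAt_const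
  have hγc : Continuous γ := by fun_prop
  have h0 : (fun τ => Φ (C.pot h (γ τ))) =ᶠ[𝓝 0] 0 := by
    have hγ0 : γ 0 = x₁ := by simp [γ]
    have h3 : ∀ᶠ y in 𝓝 (γ 0), f y = 0 ∧ f y = C.pot h y := by
      rw [hγ0]
      exact h₁.and (heq.eventuallyEq_of_mem (Metric.isOpen_ball.mem_nhds hx₁))
    filter_upwards [hγc.continuousAt.eventually h3] with τ hτ
    rw [← hτ.2, hτ.1]
    simp
  have h4 := han.eqOn_zero_of_preconnected_of_eventuallyEq_zero isPreconnected_Icc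
    (left_mem_Icc.2 zero_le_one) h0 (right_mem_Icc.2 zero_le_one)
  have hγ1 : γ 1 = x := by simp [γ]
  simp only [hγ1, Pi.zero_apply] at h4
  rw [heq hx, h4]

/-- **Identity theorem** for solutions on a connected open set. -/
theorem CRSystem.IsSolOn.eqOn_zero [Nonempty ι] [CompleteSpace W] {C : CRSystem ι W}
    {U : Set (EuclideanSpace ℝ ι)} {f : EuclideanSpace ℝ ι → W} (hf : C.IsSolOn f U)
    (hU : IsOpen U) (hUc : IsPreconnected U) {x₁ : EuclideanSpace ℝ ι} (hx₁ : x₁ ∈ U)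
    (h₁ : f =ᶠ[𝓝 x₁] 0) : EqOn f 0 U := by
  have hsub : U ⊆ {x | f =ᶠ[𝓝 x] 0} := by
    refine hUc.subset_of_closure_inter_subset isOpen_setOfPred_eventually_nhds ⟨x₁, hx₁, h₁⟩ ?_
    rintro x ⟨hxc, hxU⟩
    obtain ⟨r, hr, hball⟩ := Metric.nhds_basis_closedBall.mem_iff.1 (hU.mem_nhds hxU)
    -- The limit point `x` is the centre of a ball that contains a point `y` near which `f`
    -- vanishes.
    obtain ⟨y, hy, hyr⟩ := Metric.mem_closure_iff.1 hxc (r / 2) (by positivity)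
    have h2 := hf.eqOn_zero_ball (x₀ := x) (r := r / 2) (by positivity)
      (by rwa [mul_div_cancel₀ _ two_ne_zero]) (by rwa [Metric.mem_ball, dist_comm]) hy
    exact h2.eventuallyEq_of_mem (Metric.ball_mem_nhds x (by positivity))
  exact fun x hx => (hsub hx).self_of_nhds

/-- **Liouville theorem**: an entire solution that tends to zero at infinity vanishes. -/
theorem CRSystem.IsSolOn.eq_zero_of_tendsto [Nonempty ι] [CompleteSpace W] {C : CRSystem ι W}
    {f : EuclideanSpace ℝ ι → W} (hf : C.IsSolOn f univ) (h0 : Tendsto f (cobounded _) (𝓝 0)) :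
    f = 0 := by
  funext x₀
  have hfc : Continuous f :=
    continuous_iff_continuousAt.2 fun x => (hf x (mem_univ x)).1.continuousAt
  obtain ⟨M, hM⟩ : ∃ M, ∀ x, ‖f x‖ ≤ M := by
    rw [Metric.cobounded_eq_cocompact] at h0
    let F : ZeroAtInftyContinuousMap (EuclideanSpace ℝ ι) W := ⟨⟨f, hfc⟩, h0⟩
    exact ⟨‖F.toBCF‖, fun x => F.toBCF.norm_coe_le_norm x⟩
  let b : ContDiffBump (0 : EuclideanSpace ℝ ι) := ⟨1, 2, one_pos, one_lt_two⟩
  let χ : EuclideanSpace ℝ ι → ℝ := b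
  have hχ : ContDiff ℝ ∞ χ := b.contDiff
  have hχc : HasCompactSupport χ := b.hasCompactSupport
  -- Rescalings of a solution are solutions. With one fixed cutoff, `f x₀` is an integral of the
  -- values `f (x₀ - R y)`, which are bounded by `M` and tend to `0` for `y ≠ 0` as `R → ∞`.
  let g : ℝ → EuclideanSpace ℝ ι → W := fun R z => f (x₀ + R • z)
  have hg : ∀ R, C.IsSolOn (g R) univ := fun R z _ => by
    have h1 : HasFDerivAt (fun z : EuclideanSpace ℝ ι => x₀ + R • z)
        (R • ContinuousLinearMap.id ℝ (EuclideanSpace ℝ ι)) z :=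
      ((hasFDerivAt_id z).const_smul R).const_add x₀
    have h2 := (hf (x₀ + R • z) (mem_univ _)).1.hasFDerivAt.comp z h1
    refine ⟨h2.differentiableAt, fun t => ?_⟩
    have h3 := (hf (x₀ + R • z) (mem_univ _)).2 t
    simp only [CRSystem.dbar] at h3 ⊢
    rw [show fderiv ℝ (g R) z = _ from h2.fderiv]
    simp [← smul_sub, h3]
  have hpot : ∀ R, C.pot (C.cut χ (g R)) 0 = kerMass ι • f x₀ := fun R => by
    rw [C.pot_cut (hg R) hχ hχc (subset_univ _) 0]
    have : χ 0 = 1 := b.one_of_mem_closedBall (Metric.mem_closedBall_self zero_le_one)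
    simp [this, g]
  have hk : ∀ v, Continuous fun y => fderiv ℝ χ y v := fun v =>
    (hχ.continuous_fderiv (by simp)).clm_apply continuous_const
  have hkc : ∀ v, HasCompactSupport fun y => fderiv ℝ χ y v := fun v =>
    (hχc.fderiv ℝ).comp_left (g := fun l : EuclideanSpace ℝ ι →L[ℝ] ℝ => l v) rfl
  have hlim : ∀ (s t : ι) (B : W →L[ℝ] W),
      Tendsto (fun R => ∫ y, ker s y • B (C.cut χ (g R) t (0 - y))) atTop (𝓝 0) := by
    intro s t B
    let β : EuclideanSpace ℝ ι → ℝ := fun z => ‖B‖ * ((‖fderiv ℝ χ z (EuclideanSpace.single t 1)‖ +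
      ‖C.coeff t‖ * ‖fderiv ℝ χ z (EuclideanSpace.single (C.lead t) 1)‖) * M)
    have hβc : Continuous β :=
      continuous_const.mul (((hk _).norm.add (continuous_const.mul (hk _).norm)).mul
        continuous_const)
    have hβs : HasCompactSupport β :=
      (((hkc _).norm.add (hkc _).norm.mul_left).mul_right).mul_left
    have hbound : ∀ R z, ‖B (C.cut χ (g R) t z)‖ ≤ β z := fun R z => by
      refine (B.le_opNorm _).trans (mul_le_mul_of_nonneg_left ?_ (norm_nonneg _))
      rw [CRSystem.cut, add_mul]
      refine (norm_sub_le _ _).trans (add_le_add ?_ ?_)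
      · rw [norm_smul]
        gcongr
        exact hM _
      · refine ((C.coeff t).le_opNorm _).trans ?_
        rw [norm_smul, mul_assoc]
        gcongr
        exact hM _
    have hlim' : Tendsto (fun R => ∫ y, ker s y • B (C.cut χ (g R) t (0 - y))) atTop
        (𝓝 (∫ y : EuclideanSpace ℝ ι, (0 : W))) := by
      refine tendsto_integral_filter_of_dominated_convergence
        (fun y => ‖ker s y • β (0 - y)‖) ?_ ?_ ?_ ?_
      · refine Eventually.of_forall fun R =>
          (measurable_kerReg _ s).aestronglyMeasurable.smul (Continuous.aestronglyMeasurable ?_)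
        exact B.continuous.comp ((C.continuous_cut
          (fun x hx => (hg R x hx).1.continuousAt) hχ (subset_univ _) t).comp
            (continuous_const.sub continuous_id))
      · refine Eventually.of_forall fun R => Eventually.of_forall fun y => ?_
        rw [norm_smul, norm_smul]
        gcongr
        exact (hbound R _).trans (le_abs_self _)
      · exact ((locallyIntegrable_ker s).integrable_smul_right_of_hasCompactSupport
          (hβc.comp (continuous_const.sub continuous_id))
          (hβs.comp_homeomorph (Homeomorph.subLeft 0))).norm
      · filter_upwards [measure_eq_zero_iff_ae_notMem.1
          (measure_singleton (0 : EuclideanSpace ℝ ι))] with y hy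
        have hy' : y ≠ 0 := by simpa using hy
        have h1 : Tendsto (fun R : ℝ => x₀ + R • (0 - y)) atTop (cobounded _) := by
          rw [← tendsto_norm_atTop_iff_cobounded]
          have h2 : Tendsto (fun R : ℝ => R * ‖y‖ - ‖x₀‖) atTop atTop :=
            tendsto_atTop_add_const_right _ _
              (tendsto_id.atTop_mul_const (norm_pos_iff.2 hy'))
          refine tendsto_atTop_mono' _ ?_ h2
          filter_upwards [eventually_ge_atTop 0] with R hR
          have h3 : R • (0 - y) = (x₀ + R • (0 - y)) - x₀ := by abel
          have h4 : ‖R • (0 - y)‖ = R * ‖y‖ := by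
            rw [norm_smul, zero_sub, norm_neg, Real.norm_of_nonneg hR]
          have h5 := norm_sub_le (x₀ + R • (0 - y)) x₀
          rw [← h3, h4] at h5
          linarith
        have h2 : Tendsto (fun R => g R (0 - y)) atTop (𝓝 0) := h0.comp h1
        have h3 : Tendsto (fun R => C.cut χ (g R) t (0 - y)) atTop (𝓝 0) := by
          have := (h2.const_smul (fderiv ℝ χ (0 - y) (EuclideanSpace.single t 1))).sub
            (((C.coeff t).continuous.tendsto _).comp
              (h2.const_smul (fderiv ℝ χ (0 - y) (EuclideanSpace.single (C.lead t) 1))))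
          simpa [CRSystem.cut] using this
        have h4 := ((B.continuous.tendsto _).comp h3).const_smul (ker s y)
        simpa using h4
    simpa using hlim'
  have hfin : Tendsto (fun R => C.pot (C.cut χ (g R)) 0) atTop (𝓝 0) := by
    have := tendsto_finsetSum (f := fun t R => (∫ y, ker t y • C.cut χ (g R) t (0 - y)) +
      ∫ y, ker (C.lead t) y • C.coeff t (C.cut χ (g R) t (0 - y))) (x := atTop)
      (a := fun _ => (0 : W)) Finset.univ fun t _ => by
        simpa using (hlim t t (ContinuousLinearMap.id ℝ W)).add (hlim (C.lead t) t (C.coeff t))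
    simpa [CRSystem.pot] using this
  simp_rw [hpot] at hfin
  have := tendsto_nhds_unique hfin tendsto_const_nhds
  exact (smul_eq_zero.1 this.symm).resolve_left (ne_of_gt kerMass_pos)

/-! ### The inhomogeneous system and decay at infinity. -/

/-- The kernel convolution is differentiable, the derivative falling on the density. -/
theorem hasFDerivAt_integral_ker [Nonempty ι] [CompleteSpace W] (t : ι)
    {g : EuclideanSpace ℝ ι → W} (hg : ContDiff ℝ 1 g) (hc : HasCompactSupport g)
    (x : EuclideanSpace ℝ ι) :
    DifferentiableAt ℝ (fun x => ∫ y, ker t y • g (x - y)) x ∧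
    ∀ v, fderiv ℝ (fun x => ∫ y, ker t y • g (x - y)) x v = ∫ y, ker t y • fderiv ℝ g (x - y) v := by
  have h1 := hc.hasFDerivAt_convolution_right (μ := volume) (ContinuousLinearMap.lsmul ℝ ℝ)
    (locallyIntegrable_ker t) hg x
  have h2 : (ker t ⋆[ContinuousLinearMap.lsmul ℝ ℝ] g) = fun x => ∫ y, ker t y • g (x - y) := by
    funext x
    rw [convolution_def]
    simp
  rw [h2] at h1
  refine ⟨h1.differentiableAt, fun v => ?_⟩
  rw [h1.fderiv, convolution_precompR_apply _ (locallyIntegrable_ker t) (hc.fderiv ℝ)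
    (hg.continuous_fderiv one_ne_zero), convolution_def]
  simp

theorem CRSystem.dbar_integral_ker [Nonempty ι] [CompleteSpace W] (C : CRSystem ι W) (s t : ι)
    {g : EuclideanSpace ℝ ι → W} (hg : ContDiff ℝ 1 g) (hc : HasCompactSupport g)
    (x : EuclideanSpace ℝ ι) :
    C.dbar s (fun x => ∫ y, ker t y • g (x - y)) x = ∫ y, ker t y • C.dbar s g (x - y) := by
  have hi : ∀ v, Integrable fun y => ker t y • fderiv ℝ g (x - y) v := fun v =>
    (locallyIntegrable_ker t).integrable_smul_right_of_hasCompactSupport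
      (((hg.continuous_fderiv one_ne_zero).clm_apply continuous_const).comp
        (continuous_const.sub continuous_id))
      (((hc.fderiv ℝ).comp_left (g := fun l : EuclideanSpace ℝ ι →L[ℝ] W => l v) rfl).comp_homeomorph
        (Homeomorph.subLeft x))
  have hi2 : Integrable fun y => ker t y • C.coeff s
      (fderiv ℝ g (x - y) (EuclideanSpace.single (C.lead s) 1)) := by
    simpa using (C.coeff s).integrable_comp (hi (EuclideanSpace.single (C.lead s) 1))
  simp only [CRSystem.dbar, (hasFDerivAt_integral_ker t hg hc x).2, smul_sub]
  rw [integral_sub (hi _) hi2, ← (C.coeff s).integral_comp_comm (hi _)]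
  simp

/-- The potential solves the inhomogeneous Cauchy–Riemann system, under the compatibility
condition. -/
theorem CRSystem.dbar_pot [Nonempty ι] [CompleteSpace W] (C : CRSystem ι W)
    {h : ι → EuclideanSpace ℝ ι → W} (hh : ∀ t, ContDiff ℝ 1 (h t))
    (hc : ∀ t, HasCompactSupport (h t)) (hcomp : ∀ s t, C.dbar s (h t) = C.dbar t (h s))
    (x : EuclideanSpace ℝ ι) :
    DifferentiableAt ℝ (C.pot h) x ∧ ∀ s, C.dbar s (C.pot h) x = kerMass ι • h s x := by
  have hhA : ∀ t, ContDiff ℝ 1 fun y => C.coeff t (h t y) := fun t =>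
    (C.coeff t).contDiff.comp (hh t)
  have hcA : ∀ t, HasCompactSupport fun y => C.coeff t (h t y) := fun t =>
    (hc t).comp_left (map_zero _)
  have hd1 := fun t => (hasFDerivAt_integral_ker t (hh t) (hc t) x).1
  have hd2 := fun t => (hasFDerivAt_integral_ker (C.lead t) (hhA t) (hcA t) x).1
  have hdiff : ∀ t, DifferentiableAt ℝ (fun x => (∫ y, ker t y • h t (x - y)) +
      ∫ y, ker (C.lead t) y • C.coeff t (h t (x - y))) x := fun t => (hd1 t).add (hd2 t)
  refine ⟨DifferentiableAt.fun_sum fun t _ => hdiff t, fun s => ?_⟩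
  have h1 : C.dbar s (C.pot h) x = ∑ t, (C.dbar s (fun x => ∫ y, ker t y • h t (x - y)) x +
      C.dbar s (fun x => ∫ y, ker (C.lead t) y • C.coeff t (h t (x - y))) x) := by
    have h2 : fderiv ℝ (C.pot h) x = ∑ t, (fderiv ℝ (fun x => ∫ y, ker t y • h t (x - y)) x +
        fderiv ℝ (fun x => ∫ y, ker (C.lead t) y • C.coeff t (h t (x - y))) x) := by
      unfold CRSystem.pot
      rw [fderiv_fun_sum fun t _ => hdiff t]
      exact Finset.sum_congr rfl fun t _ => fderiv_fun_add (hd1 t) (hd2 t)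
    simp only [CRSystem.dbar, h2, sum_apply, map_sum,
      ← Finset.sum_sub_distrib]
    refine Finset.sum_congr rfl fun t _ => ?_
    simp only [add_apply, map_add]
    abel
  -- By compatibility, `dbar s` of the potential of `h` is the potential of `t ↦ dbar t (h s)`, to
  -- which Cauchy–Pompeiu for `h s` applies.
  rw [h1, ← C.pot_dbar ((hh s).differentiable one_ne_zero) (hc s) fun t => ?_]
  · refine Finset.sum_congr rfl fun t _ => ?_
    rw [C.dbar_integral_ker s t (hh t) (hc t),
      C.dbar_integral_ker s (C.lead t) (hhA t) (hcA t), hcomp s t]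
    congr 2
    funext y
    rw [C.dbar_coeff_comp t s ((hh t).differentiable one_ne_zero _), hcomp s t]
  · have hk : ∀ v, Continuous fun y => fderiv ℝ (h s) y v := fun v =>
      ((hh s).continuous_fderiv one_ne_zero).clm_apply continuous_const
    exact (hk _).sub ((C.coeff t).continuous.comp (hk _))

/-- The kernel is `O(|y|^(-(N-1)))`, which decays because there are at least two real variables. -/
theorem tendsto_integral_ker_cobounded [Nontrivial ι] (t : ι)
    {g : EuclideanSpace ℝ ι → W} (hg : Continuous g) (hc : HasCompactSupport g) :
    Tendsto (fun x => ∫ y, ker t y • g (x - y)) (cobounded _) (𝓝 0) := by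
  have hN : (0 : ℝ) < Fintype.card ι - 1 := by
    have : (1 : ℝ) < Fintype.card ι := by exact_mod_cast Fintype.one_lt_card
    linarith
  have hswap : ∀ x, ∫ y, ker t y • g (x - y) = ∫ y, ker t (x - y) • g y := fun x => by
    rw [← integral_sub_left_eq_self _ volume x]
    simp
  simp_rw [hswap]
  obtain ⟨R, hR0, hR⟩ := (IsCompact.isBounded hc).subset_closedBall_lt 0 0
  have hbig : ∀ c : ℝ, ∀ᶠ x in cobounded (EuclideanSpace ℝ ι), c ≤ ‖x‖ := fun c =>
    tendsto_norm_cobounded_atTop.eventually_ge_atTop c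
  have : (cobounded (EuclideanSpace ℝ ι)).IsCountablyGenerated := by
    rw [← comap_norm_atTop]
    infer_instance
  have hlim : Tendsto (fun x => ∫ y, ker t (x - y) • g y) (cobounded (EuclideanSpace ℝ ι))
      (𝓝 (∫ y : EuclideanSpace ℝ ι, (0 : W))) := by
    refine tendsto_integral_filter_of_dominated_convergence (fun y => ‖g y‖) ?_ ?_ ?_ ?_
    · refine Eventually.of_forall fun x => ?_
      exact ((measurable_kerReg 0 t).comp
        (measurable_const.sub measurable_id)).aestronglyMeasurable.smul hg.aestronglyMeasurable
    · filter_upwards [hbig (R + 1)] with x hx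
      refine Eventually.of_forall fun y => ?_
      by_cases hy : y ∈ tsupport g
      · have hyR : ‖y‖ ≤ R := by simpa using hR hy
        have h1 : 1 ≤ ‖x - y‖ := by
          have := norm_sub_norm_le x y
          linarith
        have hne : x - y ≠ 0 := norm_pos_iff.1 (by linarith)
        rw [norm_smul]
        refine mul_le_of_le_one_left (norm_nonneg _) ((norm_kerReg_le le_rfl t hne).trans ?_)
        exact Real.rpow_le_one_of_one_le_of_nonpos h1 (by linarith)
      · simp [image_eq_zero_of_notMem_tsupport hy]
    · exact (hg.integrable_of_hasCompactSupport hc).norm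
    · refine Eventually.of_forall fun y => ?_
      have h1 : Tendsto (fun x : EuclideanSpace ℝ ι => ‖x - y‖) (cobounded _) atTop := by
        refine tendsto_atTop_mono (fun x => norm_sub_norm_le x y) ?_
        exact tendsto_atTop_add_const_right _ _ tendsto_norm_cobounded_atTop
      have h2 := (tendsto_rpow_neg_atTop hN).comp h1
      have h3 : Tendsto (fun x => ker t (x - y)) (cobounded _) (𝓝 0) := by
        refine squeeze_zero_norm' ?_ h2
        filter_upwards [hbig (‖y‖ + 1)] with x hx
        refine norm_kerReg_le le_rfl t fun h0 => ?_
        rw [sub_eq_zero.1 h0] at hx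
        linarith
      simpa using h3.smul_const (g y)
  simpa using hlim

theorem CRSystem.tendsto_pot_cobounded [Nontrivial ι] (C : CRSystem ι W)
    {h : ι → EuclideanSpace ℝ ι → W} (hh : ∀ t, Continuous (h t))
    (hc : ∀ t, HasCompactSupport (h t)) : Tendsto (C.pot h) (cobounded _) (𝓝 0) := by
  have := tendsto_finsetSum (f := fun t x => (∫ y, ker t y • h t (x - y)) +
      ∫ y, ker (C.lead t) y • C.coeff t (h t (x - y))) (x := cobounded (EuclideanSpace ℝ ι))
      (a := fun _ => (0 : W)) Finset.univ fun t _ => by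
        simpa using (tendsto_integral_ker_cobounded t (hh t) (hc t)).add
          (tendsto_integral_ker_cobounded (C.lead t) (g := fun y => C.coeff t (h t y))
            ((C.coeff t).continuous.comp (hh t)) ((hc t).comp_left (map_zero _)))
  rw [Finset.sum_const_zero] at this
  exact this

/-! ### Restriction to the variables of one block. -/

/-- The system in the variables of one block. -/
def CRSystem.blockSystem (C : CRSystem ι W) (b : ι) (hb : C.lead b = b) :
    CRSystem {t // C.lead t = b} W where
  lead _ := ⟨b, hb⟩
  coeff t := C.coeff t
  comm s t := C.comm s t
  sum_sq b' w := by
    by_cases h : (⟨b, hb⟩ : {t // C.lead t = b}) = b'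
    · simp only [h, Finset.filter_true]
      rw [← C.sum_sq b w]
      exact (Finset.sum_subtype (p := fun t => C.lead t = b) _ (by simp)
        fun t => C.coeff t (C.coeff t w)).symm
    · simp [h]

/-- The embedding of the space of the variables of one block. -/
noncomputable def blockEmb (p : ι → Prop) [DecidablePred p] :
    EuclideanSpace ℝ {t // p t} →L[ℝ] EuclideanSpace ℝ ι :=
  ∑ t : {t // p t}, (EuclideanSpace.proj t : EuclideanSpace ℝ {t // p t} →L[ℝ] ℝ).smulRight
    (EuclideanSpace.single (t : ι) (1 : ℝ))

theorem blockEmb_single (p : ι → Prop) [DecidablePred p] (t : {t // p t}) :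
    blockEmb p (EuclideanSpace.single t 1) = EuclideanSpace.single (t : ι) (1 : ℝ) := by
  simp [blockEmb, sum_apply]

theorem blockEmb_apply_of_not (p : ι → Prop) [DecidablePred p]
    (z : EuclideanSpace ℝ {t // p t}) {j : ι} (hj : ¬ p j) : blockEmb p z j = 0 := by
  simp only [blockEmb, sum_apply, WithLp.ofLp_sum, Finset.sum_apply]
  refine Finset.sum_eq_zero fun t _ => ?_
  have : j ≠ t := fun h => hj (h ▸ t.2)
  simp [this]

theorem blockEmb_apply (p : ι → Prop) [DecidablePred p]
    (z : EuclideanSpace ℝ {t // p t}) (t : {t // p t}) : blockEmb p z t = z t := by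
  simp only [blockEmb, sum_apply, WithLp.ofLp_sum, Finset.sum_apply]
  rw [Finset.sum_eq_single t]
  · simp
  · intro s _ hs
    have : (t : ι) ≠ s := fun h => hs (Subtype.ext h.symm)
    simp [this]
  · simp

theorem tendsto_add_blockEmb_cobounded (p : ι → Prop) [DecidablePred p] (x : EuclideanSpace ℝ ι) :
    Tendsto (fun z => x + blockEmb p z) (cobounded _) (cobounded _) := by
  have hinj : Function.Injective (blockEmb p) := fun z z' h => by
    ext t
    rw [← blockEmb_apply p z t, h, blockEmb_apply]
  obtain ⟨K, -, hK⟩ := (blockEmb p).toLinearMap.exists_antilipschitzWith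
    (LinearMap.ker_eq_bot.2 hinj)
  have h2 : AntilipschitzWith K fun z => x + blockEmb p z := fun z z' => by
    simpa using hK z z'
  exact h2.tendsto_cobounded

/-- A solution outside a ball that tends to zero at infinity vanishes where a variable outside of
a given block is large. -/
theorem CRSystem.IsSolOn.eq_zero_of_coord_ge [CompleteSpace W] {C : CRSystem ι W}
    {f : EuclideanSpace ℝ ι → W} {R : ℝ} (hf : C.IsSolOn f {x | R ≤ ‖x‖})
    (h0 : Tendsto f (cobounded _) (𝓝 0)) {b j : ι} (hb : C.lead b = b) (hj : C.lead j ≠ b)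
    {x : EuclideanSpace ℝ ι} (hx : R ≤ x j) : f x = 0 := by
  let L := blockEmb fun t => C.lead t = b
  -- Moving the variables of block `b` leaves the coordinate `j` unchanged, so the whole slice stays
  -- where `f` is a solution.
  have hmem : ∀ z, R ≤ ‖x + L z‖ := fun z => by
    refine (hx.trans (le_abs_self _)).trans ?_
    have : x j = (x + L z) j := by
      simp [L, blockEmb_apply_of_not (fun t => C.lead t = b) z hj]
    rw [this]
    exact abs_coord_le j _
  have hsol : (C.blockSystem b hb).IsSolOn (fun z => f (x + L z)) univ := fun z _ => by
    have h2 := (hf _ (hmem z)).1.hasFDerivAt.comp z (L.hasFDerivAt.const_add x)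
    refine ⟨h2.differentiableAt, fun t => ?_⟩
    have h3 := (hf _ (hmem z)).2 t
    simp only [CRSystem.dbar] at h3 ⊢
    rw [show fderiv ℝ (fun z => f (x + L z)) z = _ from h2.fderiv]
    simp only [CRSystem.blockSystem, ContinuousLinearMap.comp_apply, L, blockEmb_single]
    -- The equations for `t` in the block differentiate only along the block, so they restrict to
    -- the slice and Liouville applies there.
    rw [t.2] at h3
    exact h3
  have : Nonempty {t // C.lead t = b} := ⟨⟨b, hb⟩⟩
  have h4 := hsol.eq_zero_of_tendsto (h0.comp (tendsto_add_blockEmb_cobounded _ x))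
  simpa using congrFun h4 0

theorem CRSystem.contDiffAt_dbar (C : CRSystem ι W) (t : ι) {g : EuclideanSpace ℝ ι → W}
    {x : EuclideanSpace ℝ ι} (hg : ContDiffAt ℝ ∞ g x) : ContDiffAt ℝ ∞ (C.dbar t g) x := by
  have h1 : ContDiffAt ℝ ∞ (fderiv ℝ g) x := hg.fderiv_right (by simp)
  have h2 : ∀ v, ContDiffAt ℝ ∞ (fun y => fderiv ℝ g y v) x := fun v =>
    h1.clm_apply contDiffAt_const
  exact (h2 _).sub ((C.coeff t).contDiff.contDiffAt.comp x (h2 _))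

/-- Second derivatives are symmetric and the coefficients commute; this provides the compatibility
condition for data of the form `d''g`. -/
theorem CRSystem.dbar_comm (C : CRSystem ι W) (s t : ι) {g : EuclideanSpace ℝ ι → W}
    {x : EuclideanSpace ℝ ι} (hg : ContDiffAt ℝ ∞ g x) :
    C.dbar s (C.dbar t g) x = C.dbar t (C.dbar s g) x := by
  have h1 : HasFDerivAt (fderiv ℝ g) (fderiv ℝ (fderiv ℝ g) x) x :=
    ((hg.fderiv_right (m := ∞) (by simp)).differentiableAt (by simp)).hasFDerivAt
  have h2 : ∀ t v, fderiv ℝ (C.dbar t g) x v =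
      fderiv ℝ (fderiv ℝ g) x v (EuclideanSpace.single t 1) -
        C.coeff t (fderiv ℝ (fderiv ℝ g) x v (EuclideanSpace.single (C.lead t) 1)) := by
    intro t v
    have h3 : ∀ w, HasFDerivAt (fun y => fderiv ℝ g y w)
        ((ContinuousLinearMap.apply ℝ W w).comp (fderiv ℝ (fderiv ℝ g) x)) x := fun w =>
      (ContinuousLinearMap.apply ℝ W w).hasFDerivAt.comp x h1
    have h4 := (h3 (EuclideanSpace.single t 1)).sub
      ((C.coeff t).hasFDerivAt.comp x (h3 (EuclideanSpace.single (C.lead t) 1)))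
    rw [show fderiv ℝ (C.dbar t g) x = _ from h4.fderiv]
    simp
  have hsymm := hg.isSymmSndFDerivAt (by
    rw [minSmoothness_of_isRCLikeNormedField]
    exact WithTop.coe_le_coe.2 (le_top : (2 : ℕ∞) ≤ ⊤))
  have e := fun v w => hsymm.eq v w
  rw [CRSystem.dbar, CRSystem.dbar, h2, h2, h2, h2, map_sub, map_sub, C.comm s t,
    e (EuclideanSpace.single s 1) (EuclideanSpace.single t 1),
    e (EuclideanSpace.single s 1) (EuclideanSpace.single (C.lead t) 1),
    e (EuclideanSpace.single (C.lead s) 1) (EuclideanSpace.single t 1),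
    e (EuclideanSpace.single (C.lead s) 1) (EuclideanSpace.single (C.lead t) 1)]
  abel

/-- Solution of the inhomogeneous Cauchy–Riemann system with compactly supported right-hand side. -/
theorem CRSystem.exists_dbar_eq [Nontrivial ι] [CompleteSpace W] (C : CRSystem ι W)
    {h : ι → EuclideanSpace ℝ ι → W} (hh : ∀ t, ContDiff ℝ 1 (h t))
    (hc : ∀ t, HasCompactSupport (h t)) (hcomp : ∀ s t, C.dbar s (h t) = C.dbar t (h s)) :
    ∃ u : EuclideanSpace ℝ ι → W, Differentiable ℝ u ∧ (∀ s, C.dbar s u = h s) ∧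
      Tendsto u (cobounded _) (𝓝 0) := by
  refine ⟨fun x => (kerMass ι)⁻¹ • C.pot h x,
    fun x => (C.dbar_pot hh hc hcomp x).1.const_smul _, fun s => funext fun x => ?_, ?_⟩
  · have h1 := C.dbar_smul s (differentiableAt_const (kerMass ι)⁻¹)
      (C.dbar_pot hh hc hcomp x).1
    rw [h1, (C.dbar_pot hh hc hcomp x).2, C.cut_eq_zero _ _ (by simp), add_zero,
      inv_smul_smul₀ kerMass_pos.ne']
  · simpa using (C.tendsto_pot_cobounded (fun t => (hh t).continuous) hc).const_smul (kerMass ι)⁻¹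

/-! ### Hartogs' extension theorem. -/

/-- The point where a ray starting in a bounded open set finally leaves its closure. -/
theorem exists_last_exit {E : Type*} [NormedAddCommGroup E] [NormedSpace ℝ E] {Ω : Set E}
    (hΩ : IsOpen Ω) (hb : IsBounded Ω) {x₀ v : E} (hx₀ : x₀ ∈ Ω) (hv : v ≠ 0) :
    ∃ s₀ : ℝ, x₀ + s₀ • v ∈ frontier Ω ∧ ∀ s, s₀ ≤ s → x₀ + s • v ∉ Ω := by
  obtain ⟨M, hM⟩ := hb.closure.subset_closedBall x₀
  have hvn := norm_pos_iff.2 hv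
  have hcont : Continuous fun s : ℝ => x₀ + s • v := by fun_prop
  let S : Set ℝ := Icc 0 (M / ‖v‖) ∩ (fun s : ℝ => x₀ + s • v) ⁻¹' closure Ω
  have hS : ∀ s, 0 ≤ s → x₀ + s • v ∈ closure Ω → s ∈ S := fun s hs h => by
    refine ⟨⟨hs, ?_⟩, h⟩
    have := hM h
    rw [mem_closedBall_iff_norm, add_sub_cancel_left, norm_smul, Real.norm_of_nonneg hs] at this
    rwa [le_div_iff₀ hvn]
  have hSc : IsCompact S := isCompact_Icc.inter_right (isClosed_closure.preimage hcont)
  have h0S : (0 : ℝ) ∈ S := hS 0 le_rfl (by simpa using subset_closure hx₀)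
  obtain ⟨s₀, hs₀, hmax⟩ := hSc.exists_isGreatest ⟨0, h0S⟩
  have hout : ∀ s, s₀ < s → x₀ + s • v ∉ closure Ω := fun s hs h =>
    absurd (hmax (hS s (hs₀.1.1.trans hs.le) h)) (not_le.2 hs)
  -- If this point were in the open set `Ω`, slightly larger parameters would be too, against the
  -- maximality of `s₀`.
  have hnot : x₀ + s₀ • v ∉ Ω := fun h => by
    have h1 : ∀ᶠ s in 𝓝[>] s₀, x₀ + s • v ∈ Ω :=
      (hcont.continuousAt.eventually (hΩ.mem_nhds h)).filter_mono nhdsWithin_le_nhds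
    obtain ⟨s, hs, hs'⟩ := (h1.and self_mem_nhdsWithin).exists
    exact hout s hs' (subset_closure hs)
  refine ⟨s₀, ⟨hs₀.2, by rwa [hΩ.interior_eq]⟩, fun s hs => ?_⟩
  rcases hs.eq_or_lt with rfl | hlt
  · exact hnot
  · exact fun h => hout s hlt (subset_closure h)

theorem exists_smooth_cutoff {K Ω : Set (EuclideanSpace ℝ ι)} (hK : IsCompact K) (hΩ : IsOpen Ω)
    (hKΩ : K ⊆ Ω) : ∃ (χ : EuclideanSpace ℝ ι → ℝ) (T : Set (EuclideanSpace ℝ ι)),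
      ContDiff ℝ ∞ χ ∧ IsCompact T ∧ K ⊆ T ∧ T ⊆ Ω ∧ (∀ x ∈ K, χ =ᶠ[𝓝 x] 1) ∧
      ∀ x ∉ T, χ x = 0 := by
  obtain ⟨T, hT, hKT, hTΩ⟩ := exists_compact_between hK hΩ hKΩ
  obtain ⟨χ, h1, h0, -⟩ := exists_contMDiffMap_one_nhds_of_subset_interior
    (n := ⊤) 𝓘(ℝ, EuclideanSpace ℝ ι) hK.isClosed hKT
  exact ⟨χ, T, χ.contMDiff.contDiff, hT, hKT.trans interior_subset, hTΩ,
    fun x hx => (eventually_nhdsSet_iff_forall.1 h1) x hx, h0⟩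

/-- **Hartogs' extension theorem** for systems of Cauchy–Riemann type with at least two blocks. -/
theorem CRSystem.IsSolOn.exists_extension [FiniteDimensional ℝ W] {C : CRSystem ι W} {b j : ι}
    (hb : C.lead b = b) (hj : C.lead j ≠ b) {Ω V : Set (EuclideanSpace ℝ ι)} (hΩ : IsOpen Ω)
    (hΩne : Ω.Nonempty) (hΩb : IsBounded Ω) (hV : IsOpen V) (hVc : IsPreconnected V)
    (hΩV : frontier Ω ⊆ V) {f : EuclideanSpace ℝ ι → W} (hf : C.IsSolOn f V) :
    ∃ F : EuclideanSpace ℝ ι → W, C.IsSolOn F (Ω ∪ V) ∧ EqOn F f V := by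
  classical
  have : CompleteSpace W := FiniteDimensional.complete ℝ W
  have : Nontrivial ι := ⟨b, j, fun h => hj (h ▸ hb)⟩
  -- This is the hole to be filled: the part of `closure Ω` where `f` is not assumed to be a
  -- solution. It lies inside `Ω` since the boundary lies in `V`.
  have hK : IsCompact (closure Ω \ V) := hΩb.isCompact_closure.diff hV
  have hKΩ : closure Ω \ V ⊆ Ω := fun x hx => by
    by_contra hxΩ
    exact hx.2 (hΩV ⟨hx.1, by rwa [hΩ.interior_eq]⟩)
  obtain ⟨χ, T, hχ, hT, hKT, hTΩ, hχ1, hχ0⟩ := exists_smooth_cutoff hK hΩ hKΩ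
  have hmemV : ∀ x ∈ Ω, x ∉ T → x ∈ V := fun x hx hxT => by
    by_contra hxV
    exact hxT (hKT ⟨subset_closure hx, hxV⟩)
  have hTn : ∀ x ∉ T, Tᶜ ∈ 𝓝 x := fun x hx => hT.isClosed.isOpen_compl.mem_nhds hx
  -- Since `1 - χ = 0` near the hole, extension by zero keeps `g` smooth on `Ω ∪ V`.
  let g : EuclideanSpace ℝ ι → W := fun x => if x ∈ V then (1 - χ x) • f x else 0
  have hgV : ∀ x ∈ V, g =ᶠ[𝓝 x] fun y => (1 - χ y) • f y := fun x hx => by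
    filter_upwards [hV.mem_nhds hx] with y hy
    simp [g, hy]
  have hgf : ∀ x ∈ V, x ∉ T → g =ᶠ[𝓝 x] f := fun x hx hxT => by
    filter_upwards [hV.mem_nhds hx, hTn x hxT] with y hy hyT
    simp [g, hy, hχ0 y hyT]
  have hgK : ∀ x ∈ Ω, x ∉ V → g =ᶠ[𝓝 x] fun _ => 0 := fun x hx hxV => by
    filter_upwards [hχ1 x ⟨subset_closure hx, hxV⟩] with y hy
    simp [g, hy]
  have hgs : ∀ x ∈ Ω ∪ V, ContDiffAt ℝ ∞ g x := fun x hx => by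
    by_cases hxV : x ∈ V
    · exact ((contDiffAt_const.sub hχ.contDiffAt).smul
        (hf.contDiffAt hV hxV)).congr_of_eventuallyEq (hgV x hxV)
    · exact contDiffAt_const.congr_of_eventuallyEq (hgK x (hx.resolve_right hxV) hxV)
  -- On `Ω` off `T`, `g` agrees locally with the solution `f`, so `d''g = 0` there and the extension
  -- by zero is smooth with support in `T`.
  let η : ι → EuclideanSpace ℝ ι → W := fun s x => if x ∈ Ω then C.dbar s g x else 0
  have hη0 : ∀ s, ∀ x ∉ T, η s x = 0 := fun s x hx => by
    by_cases hxΩ : x ∈ Ω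
    · have hxV := hmemV x hxΩ hx
      simp only [η, hxΩ, if_true]
      rw [C.dbar_congr s (hgf x hxV hx), (hf x hxV).2]
    · simp [η, hxΩ]
  have hηe : ∀ s, ∀ x ∉ T, η s =ᶠ[𝓝 x] fun _ => 0 := fun s x hx => by
    filter_upwards [hTn x hx] with y hy using hη0 s y hy
  have hηΩ : ∀ s, ∀ x ∈ Ω, η s =ᶠ[𝓝 x] C.dbar s g := fun s x hx => by
    filter_upwards [hΩ.mem_nhds hx] with y hy
    simp [η, hy]
  have hηs : ∀ s, ContDiff ℝ 1 (η s) := fun s => contDiff_iff_contDiffAt.2 fun x => by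
    by_cases hx : x ∈ T
    · exact ((C.contDiffAt_dbar s (hgs x (Or.inl (hTΩ hx)))).congr_of_eventuallyEq
        (hηΩ s x (hTΩ hx))).of_le (by simp)
    · exact contDiffAt_const.congr_of_eventuallyEq (hηe s x hx)
  have hηc : ∀ s, HasCompactSupport (η s) := fun s =>
    HasCompactSupport.intro hT fun x hx => hη0 s x hx
  have hcomp : ∀ s t, C.dbar s (η t) = C.dbar t (η s) := fun s t => funext fun x => by
    by_cases hx : x ∈ T
    · rw [C.dbar_congr s (hηΩ t x (hTΩ hx)), C.dbar_congr t (hηΩ s x (hTΩ hx)),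
        C.dbar_comm s t (hgs x (Or.inl (hTΩ hx)))]
    · rw [C.dbar_congr s (hηe t x hx), C.dbar_congr t (hηe s x hx)]
      simp [CRSystem.dbar]
  obtain ⟨u, hud, hu, hulim⟩ := C.exists_dbar_eq hηs hηc hcomp
  have huT : C.IsSolOn u Tᶜ := fun x hx => ⟨hud x, fun s => by rw [hu, hη0 s x hx]⟩
  have hF : C.IsSolOn (fun x => g x - u x) (Ω ∪ V) := fun x hx => by
    have hgd : DifferentiableAt ℝ g x := (hgs x hx).differentiableAt (by simp)
    refine ⟨hgd.sub (hud x), fun s => ?_⟩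
    rw [C.dbar_sub s hgd (hud x), hu]
    by_cases hxΩ : x ∈ Ω
    · simp [η, hxΩ]
    · have hxV := hx.resolve_left hxΩ
      have hxT : x ∉ T := fun h => hxΩ (hTΩ h)
      rw [C.dbar_congr s (hgf x hxV hxT), (hf x hxV).2, hη0 s x hxT, sub_zero]
  refine ⟨_, hF, ?_⟩
  obtain ⟨R, hR⟩ := hT.isBounded.subset_ball 0
  -- Here the second block is used: slices along block `b` through the half-space `x_j ≥ R` miss
  -- `T`.
  have hfar : ∀ x : EuclideanSpace ℝ ι, R ≤ x j → u x = 0 := fun x hx =>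
    (huT.mono fun y (hy : R ≤ ‖y‖) hyT => absurd (mem_ball_zero_iff.1 (hR hyT))
      (not_lt.2 hy)).eq_zero_of_coord_ge hulim hb hj hx
  obtain ⟨x₀, hx₀⟩ := hΩne
  -- Beyond its last exit from `closure Ω` the ray in direction `j` stays off `T` and runs into that
  -- half-space, so it joins a boundary point of `Ω` to the region where `u = 0` within one
  -- component of `Tᶜ`.
  obtain ⟨s₀, hs₀, hray⟩ := exists_last_exit hΩ hΩb hx₀
    (v := (EuclideanSpace.single j 1 : EuclideanSpace ℝ ι)) (by simp)
  set γ : ℝ → EuclideanSpace ℝ ι := fun s => x₀ + s • EuclideanSpace.single j 1 with hγ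
  have hγc : Continuous γ := by fun_prop
  have hrayT : γ '' Ici s₀ ⊆ Tᶜ := by
    rintro _ ⟨s, hs, rfl⟩ h
    exact hray s hs (hTΩ h)
  have hmem₀ : γ s₀ ∈ γ '' Ici s₀ := mem_image_of_mem γ self_mem_Ici
  have hUo : IsOpen (connectedComponentIn Tᶜ (γ s₀)) :=
    hT.isClosed.isOpen_compl.connectedComponentIn
  have hrayU : γ '' Ici s₀ ⊆ connectedComponentIn Tᶜ (γ s₀) :=
    (isPreconnected_Ici.image γ hγc.continuousOn).subset_connectedComponentIn hmem₀ hrayT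
  obtain ⟨s₁, hs₁, hs₁R⟩ : ∃ s₁, s₀ ≤ s₁ ∧ R < γ s₁ j := by
    refine ⟨max s₀ (R - x₀ j + 1), le_max_left _ _, ?_⟩
    have := le_max_right s₀ (R - x₀ j + 1)
    simp only [hγ, PiLp.add_apply, PiLp.smul_apply, PiLp.single_apply, if_true, smul_eq_mul, mul_one]
    linarith
  have hu0 : EqOn u 0 (connectedComponentIn Tᶜ (γ s₀)) := by
    refine (huT.mono (connectedComponentIn_subset _ _)).eqOn_zero hUo
      isPreconnected_connectedComponentIn (hrayU (mem_image_of_mem γ hs₁)) ?_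
    have hopen : IsOpen {x : EuclideanSpace ℝ ι | R < x j} :=
      isOpen_lt continuous_const (EuclideanSpace.proj j : EuclideanSpace ℝ ι →L[ℝ] ℝ).continuous
    filter_upwards [hopen.mem_nhds hs₁R] with y hy
    exact hfar y (le_of_lt hy)
  have hdiff : C.IsSolOn (fun x => (g x - u x) - f x) V :=
    (hF.mono subset_union_right).sub hf
  -- Near the exit point `g = f` and `u = 0`; connectedness of `V` spreads the equality.
  have h0 := hdiff.eqOn_zero hV hVc (hΩV hs₀) (by
    filter_upwards [hgf _ (hΩV hs₀) (hrayT hmem₀), hUo.mem_nhds (hrayU hmem₀)] with y hy hyU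
    simp [hy, hu0 hyU])
  exact fun x hx => sub_eq_zero.1 (h0 hx)

end CRSystem

/-! ### Blocks of odd indices. -/

namespace BlockSeq

variable {q r : ℕ} (S : BlockSeq q r)

theorem exists_mem_block (t : Fin q) : ∃ k, t ∈ S.block k := by
  by_contra! h
  -- If `t` lay in no block, it would pass every `s_k` in turn, the last one `q` included.
  have h1 : ∀ k : Fin (r + 1), S.s k ≤ t := fun k => by
    induction k using Fin.induction with
    | zero => simp [S.s_zero]
    | succ k ih =>
      by_contra! hlt
      exact h k (by simp [block, ih, hlt])
  have h2 := h1 (Fin.last r)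
  rw [S.s_last] at h2
  exact absurd t.2 (not_lt.2 h2)

theorem eq_of_mem_block {k k' : Fin r} {t : Fin q} (h : t ∈ S.block k) (h' : t ∈ S.block k') :
    k = k' := by
  simp only [block, Finset.mem_filter, Finset.mem_univ, true_and] at h h'
  by_contra hne
  rcases lt_or_gt_of_ne hne with hlt | hlt
  · have : S.s k.succ ≤ S.s k'.castSucc := S.strictMono.monotone (Fin.succ_le_castSucc_iff.2 hlt)
    omega
  · have : S.s k'.succ ≤ S.s k.castSucc := S.strictMono.monotone (Fin.succ_le_castSucc_iff.2 hlt)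
    omega

theorem lead_mem_block (k : Fin r) : S.lead k ∈ S.block k := by
  simp only [block, lead, Finset.mem_filter, Finset.mem_univ, true_and, le_refl]
  exact S.strictMono Fin.castSucc_lt_succ

/-- The index of the block containing `t`. -/
noncomputable def blockOf (t : Fin q) : Fin r := (S.exists_mem_block t).choose

theorem mem_block_blockOf (t : Fin q) : t ∈ S.block (S.blockOf t) :=
  (S.exists_mem_block t).choose_spec

theorem blockOf_eq_iff {t : Fin q} {k : Fin r} : S.blockOf t = k ↔ t ∈ S.block k :=
  ⟨fun h => h ▸ S.mem_block_blockOf t, fun h => S.eq_of_mem_block (S.mem_block_blockOf t) h⟩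

theorem blockOf_lead (k : Fin r) : S.blockOf (S.lead k) = k :=
  S.blockOf_eq_iff.2 (S.lead_mem_block k)

end BlockSeq

variable {Λ : Type*} [NormedRing Λ] [NormedAlgebra ℝ Λ] {𝒜 : ZMod 2 → Submodule ℝ Λ}
  {p q r : ℕ}

theorem IsSupercommutative.commute (hΛ : IsSupercommutative 𝒜) {x y : Λ} (hx : x ∈ 𝒜 0)
    (hy : y ∈ 𝒜 0) : x * y = y * x := by
  simpa using hΛ 0 0 x y hx hy

/-! ### The superspace in real coordinates. -/

/-- The index set of the real coordinates of `Λ₀ⁿ × Λ₁ᵐ`. -/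
abbrev CoordIdx (n m p q : ℕ) : Type := (Σ _ : Fin n, Fin (p + 1)) ⊕ (Σ _ : Fin m, Fin q)

/-- The leading coordinate of the block of a coordinate. -/
noncomputable def coordLead (n m p : ℕ) (S : BlockSeq q r) : CoordIdx n m p q → CoordIdx n m p q :=
  Sum.elim (fun t => Sum.inl ⟨t.1, 0⟩) fun t => Sum.inr ⟨t.1, S.lead (S.blockOf t.2)⟩

/-- The coefficient of a coordinate in the Cauchy–Riemann equations. -/
noncomputable def coordCoeff (n m : ℕ) (e : Module.Basis (Fin (p + 1)) ℝ (𝒜 0)) (a : Fin q → 𝒜 0) :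
    CoordIdx n m p q → 𝒜 0 :=
  Sum.elim (fun t => e t.2) fun t => a t.2

/-- A fibre of `coordLead` is either empty or one block: all coordinates of a single `y_i`, or one
odd block of a single `θ_l`. The two basis conditions treat these cases. -/
theorem sum_sq_coordCoeff (n m : ℕ) {e : Module.Basis (Fin (p + 1)) ℝ (𝒜 0)}
    (hA0 : ConditionA0 𝒜 e) {ε : Module.Basis (Fin q) ℝ (𝒜 1)} {S : BlockSeq q r}
    {a : Fin q → 𝒜 0} (hA1 : ConditionA1 𝒜 ε S a) (b : CoordIdx n m p q) :
    ∑ t with coordLead n m p S t = b, (coordCoeff n m e a t : Λ) ^ 2 = 0 := by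
  rw [Finset.sum_filter, Fintype.sum_sum_type, Fintype.sum_sigma, Fintype.sum_sigma]
  rcases b with ⟨i₀, j₀⟩ | ⟨l₀, t₀⟩
  · have h1 : ∀ i : Fin n, ∑ j : Fin (p + 1),
        (if coordLead n m p S (Sum.inl ⟨i, j⟩) = Sum.inl ⟨i₀, j₀⟩ then
          (coordCoeff n m e a (Sum.inl ⟨i, j⟩) : Λ) ^ 2 else 0) = 0 := fun i => by
      simp only [coordLead, coordCoeff, Sum.elim_inl, Sum.inl.injEq]
      by_cases h : (⟨i, 0⟩ : Σ _ : Fin n, Fin (p + 1)) = ⟨i₀, j₀⟩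
      · simp only [h, if_true]
        exact hA0.2
      · simp [h]
    simp only [h1, Finset.sum_const_zero, zero_add]
    simp [coordLead]
  · have h1 : ∀ l : Fin m, ∑ t : Fin q,
        (if coordLead n m p S (Sum.inr ⟨l, t⟩) = Sum.inr ⟨l₀, t₀⟩ then
          (coordCoeff n m e a (Sum.inr ⟨l, t⟩) : Λ) ^ 2 else 0) = 0 := fun l => by
      simp only [coordLead, coordCoeff, Sum.elim_inr, Sum.inr.injEq]
      by_cases h : l = l₀ ∧ ∃ k, S.lead k = t₀
      · obtain ⟨rfl, k, rfl⟩ := h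
        rw [← Finset.sum_filter]
        refine Eq.trans ?_ (hA1 k).2.2
        refine Finset.sum_congr ?_ fun _ _ => rfl
        ext t
        simp only [Finset.mem_filter, Finset.mem_univ, true_and, Sigma.mk.injEq, heq_eq_eq,
          ← S.blockOf_eq_iff]
        refine ⟨fun h => ?_, fun h => by rw [h]⟩
        rw [← S.blockOf_lead (S.blockOf t), h, S.blockOf_lead]
      · refine Finset.sum_eq_zero fun t _ => if_neg fun h' => h ?_
        simp only [Sigma.mk.injEq, heq_eq_eq] at h'
        exact ⟨h'.1, _, h'.2⟩
    simp only [h1, Finset.sum_const_zero, add_zero]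
    simp [coordLead]

/-- The Cauchy–Riemann equations on `Λ₀ⁿ × Λ₁ᵐ`, in real coordinates. -/
noncomputable def superSystem (n m : ℕ) (hΛ : IsSupercommutative 𝒜)
    {e : Module.Basis (Fin (p + 1)) ℝ (𝒜 0)} (hA0 : ConditionA0 𝒜 e)
    {ε : Module.Basis (Fin q) ℝ (𝒜 1)} {S : BlockSeq q r} {a : Fin q → 𝒜 0}
    (hA1 : ConditionA1 𝒜 ε S a) : CRSystem (CoordIdx n m p q) Λ where
  lead := coordLead n m p S
  coeff t := ContinuousLinearMap.mul ℝ Λ (coordCoeff n m e a t)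
  comm s t w := by
    simp only [ContinuousLinearMap.mul_apply', ← mul_assoc]
    rw [hΛ.commute (coordCoeff n m e a s).2 (coordCoeff n m e a t).2]
  sum_sq b w := by
    simp only [ContinuousLinearMap.mul_apply', ← mul_assoc, ← Finset.sum_mul, ← sq,
      sum_sq_coordCoeff n m hA0 hA1 b, zero_mul]

/-- The basis of `Λ₀ⁿ × Λ₁ᵐ` given by bases of `Λ₀` and `Λ₁`. -/
noncomputable def superBasis (n m : ℕ) (e : Module.Basis (Fin (p + 1)) ℝ (𝒜 0))
    (ε : Module.Basis (Fin q) ℝ (𝒜 1)) :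
    Module.Basis (CoordIdx n m p q) ℝ (Superspace 𝒜 n m) :=
  (Pi.basis fun _ => e).prod (Pi.basis fun _ => ε)

theorem superBasis_inl (n m : ℕ) (e : Module.Basis (Fin (p + 1)) ℝ (𝒜 0))
    (ε : Module.Basis (Fin q) ℝ (𝒜 1)) (i : Fin n) (j : Fin (p + 1)) :
    superBasis n m e ε (Sum.inl ⟨i, j⟩) = (Pi.single i (e j), 0) := by
  simp [superBasis, Module.Basis.prod_apply]

theorem superBasis_inr (n m : ℕ) (e : Module.Basis (Fin (p + 1)) ℝ (𝒜 0))
    (ε : Module.Basis (Fin q) ℝ (𝒜 1)) (l : Fin m) (t : Fin q) :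
    superBasis n m e ε (Sum.inr ⟨l, t⟩) = (0, Pi.single l (ε t)) := by
  simp [superBasis, Module.Basis.prod_apply]

/-- The real coordinates on `Λ₀ⁿ × Λ₁ᵐ`, as a map to Euclidean space. -/
noncomputable def superCoord [FiniteDimensional ℝ Λ] (n m : ℕ)
    (e : Module.Basis (Fin (p + 1)) ℝ (𝒜 0)) (ε : Module.Basis (Fin q) ℝ (𝒜 1)) :
    Superspace 𝒜 n m ≃L[ℝ] EuclideanSpace ℝ (CoordIdx n m p q) :=
  ((superBasis n m e ε).equivFun ≪≫ₗ (WithLp.linearEquiv 2 ℝ _).symm).toContinuousLinearEquiv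

theorem superCoord_symm_single [FiniteDimensional ℝ Λ] (n m : ℕ)
    (e : Module.Basis (Fin (p + 1)) ℝ (𝒜 0)) (ε : Module.Basis (Fin q) ℝ (𝒜 1))
    (t : CoordIdx n m p q) :
    (superCoord n m e ε).symm (EuclideanSpace.single t 1) = superBasis n m e ε t := by
  rw [ContinuousLinearEquiv.symm_apply_eq]
  ext s
  simp [superCoord, Finsupp.single_apply, eq_comm]

section Components

variable {n m : ℕ} {e : Module.Basis (Fin (p + 1)) ℝ (𝒜 0)} {ε : Module.Basis (Fin q) ℝ (𝒜 1)}
  {S : BlockSeq q r} {a : Fin q → 𝒜 0} {f : Superspace 𝒜 n m → Λ} {x : Superspace 𝒜 n m}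

/-- Evaluation on a coordinate vector isolates one component of the form; with the odd counterpart
this separates the equations. -/
theorem cauchyRiemann_apply_even (i : Fin n) (j : Fin p) :
    cauchyRiemann e ε S a f x (Pi.single i (e j.succ), 0) =
      partialY e f x i j.succ - (e j.succ : Λ) * partialY e f x i 0 := by
  have h1 : ∀ l t, dθ (n := n) ε l t (Pi.single i (e j.succ), (0 : Fin m → 𝒜 1)) = 0 := by
    simp [dθ]
  have h2 : ∀ i' (j' : Fin p), dy (m := m) e i' j'.succ (Pi.single i (e j.succ), 0) =
      if i' = i ∧ j' = j then 1 else 0 := fun i' j' => by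
    by_cases hi : i' = i
    · subst hi
      simp [dy, Finsupp.single_apply, eq_comm]
    · simp [dy, hi]
  simp only [cauchyRiemann, LinearMap.add_apply, LinearMap.sum_apply, LinearMap.smulRight_apply,
    h1, h2, zero_smul, Finset.sum_const_zero, add_zero]
  rw [Finset.sum_eq_single i (fun i' _ hi => by simp [hi]) (by simp),
    Finset.sum_eq_single j (fun j' _ hj => by simp [hj]) (by simp)]
  simp

theorem cauchyRiemann_apply_odd (l : Fin m) (k : Fin r) {t : Fin q}
    (ht : t ∈ (S.block k).erase (S.lead k)) :
    cauchyRiemann e ε S a f x (0, Pi.single l (ε t)) =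
      partialθ ε f x l t - (a t : Λ) * partialθ ε f x l (S.lead k) := by
  have h1 : ∀ i j, dy (m := m) e i j ((0 : Fin n → 𝒜 0), Pi.single l (ε t)) = 0 := by
    simp [dy]
  have h2 : ∀ l' t', dθ (n := n) ε l' t' (0, Pi.single l (ε t)) =
      if l' = l ∧ t' = t then 1 else 0 := fun l' t' => by
    by_cases hl : l' = l
    · subst hl
      simp [dθ, Finsupp.single_apply, eq_comm]
    · simp [dθ, hl]
  simp only [cauchyRiemann, LinearMap.add_apply, LinearMap.sum_apply, LinearMap.smulRight_apply,
    h1, h2, zero_smul, Finset.sum_const_zero, zero_add]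
  rw [Finset.sum_eq_single l (fun l' _ hl => by simp [hl]) (by simp),
    Finset.sum_eq_single k ?_ (by simp),
    Finset.sum_eq_single t (fun t' _ ht' => by simp [ht']) (fun h => absurd ht h)]
  · simp
  · refine fun k' _ hk => Finset.sum_eq_zero fun t' ht' => ?_
    have : t' ≠ t := fun h => hk (S.eq_of_mem_block (h ▸ Finset.mem_of_mem_erase ht')
      (Finset.mem_of_mem_erase ht))
    simp [this]

/-- The form `d''f` vanishes iff its components do. -/
theorem cauchyRiemann_eq_zero_iff :
    cauchyRiemann e ε S a f x = 0 ↔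
      (∀ i (j : Fin p), partialY e f x i j.succ = (e j.succ : Λ) * partialY e f x i 0) ∧
      ∀ l k, ∀ t ∈ (S.block k).erase (S.lead k),
        partialθ ε f x l t = (a t : Λ) * partialθ ε f x l (S.lead k) := by
  refine ⟨fun h => ⟨fun i j => ?_, fun l k t ht => ?_⟩, fun h => ?_⟩
  · rw [← sub_eq_zero, ← cauchyRiemann_apply_even (ε := ε) (S := S) (a := a), h]
    rfl
  · rw [← sub_eq_zero, ← cauchyRiemann_apply_odd (e := e) l k ht, h]
    rfl
  · rw [cauchyRiemann, Finset.sum_eq_zero fun i _ => Finset.sum_eq_zero fun j _ => ?_,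
      Finset.sum_eq_zero fun l _ => Finset.sum_eq_zero fun k _ => Finset.sum_eq_zero fun t ht => ?_,
      add_zero]
    · rw [h.2 l k t ht, sub_self]
      ext <;> simp
    · rw [h.1 i j, sub_self]
      ext <;> simp

end Components

theorem differentiableAt_comp_symm_iff {X Y Z : Type*} [NormedAddCommGroup X] [NormedSpace ℝ X]
    [NormedAddCommGroup Y] [NormedSpace ℝ Y] [NormedAddCommGroup Z] [NormedSpace ℝ Z]
    (Φ : X ≃L[ℝ] Y) (f : X → Z) (y : Y) :
    DifferentiableAt ℝ (fun z => f (Φ.symm z)) y ↔ DifferentiableAt ℝ f (Φ.symm y) :=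
  Φ.symm.comp_right_differentiableAt_iff

theorem fderiv_comp_symm {X Y Z : Type*} [NormedAddCommGroup X] [NormedSpace ℝ X]
    [NormedAddCommGroup Y] [NormedSpace ℝ Y] [NormedAddCommGroup Z] [NormedSpace ℝ Z]
    (Φ : X ≃L[ℝ] Y) (f : X → Z) (y v : Y) :
    fderiv ℝ (fun z => f (Φ.symm z)) y v = fderiv ℝ f (Φ.symm y) (Φ.symm v) := by
  have : fderiv ℝ (fun z => f (Φ.symm z)) y = _ := Φ.symm.comp_right_fderiv (f := f)
  rw [this]
  rfl

section Transfer

variable [FiniteDimensional ℝ Λ] {n m : ℕ} (hΛ : IsSupercommutative 𝒜)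
  {e : Module.Basis (Fin (p + 1)) ℝ (𝒜 0)} (hA0 : ConditionA0 𝒜 e)
  {ε : Module.Basis (Fin q) ℝ (𝒜 1)} {S : BlockSeq q r} {a : Fin q → 𝒜 0}
  (hA1 : ConditionA1 𝒜 ε S a) (f : Superspace 𝒜 n m → Λ)

theorem fderiv_comp_superCoord_symm (z : EuclideanSpace ℝ (CoordIdx n m p q))
    (t : CoordIdx n m p q) :
    fderiv ℝ (fun z => f ((superCoord n m e ε).symm z)) z (EuclideanSpace.single t 1) =
      fderiv ℝ f ((superCoord n m e ε).symm z) (superBasis n m e ε t) := by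
  have h := fderiv_comp_symm (superCoord n m e ε) f z (EuclideanSpace.single t 1)
  rw [← superCoord_symm_single]
  exact h

/-- The abstract system has an equation for every coordinate, the form `d''f` only for the
non-leading ones. The additional equations are trivial because the leading coefficients `e_0` and
`a_{s_k}` equal `1`. -/
theorem cauchyRiemann_eq_zero_iff_dbar (z : EuclideanSpace ℝ (CoordIdx n m p q)) :
    cauchyRiemann e ε S a f ((superCoord n m e ε).symm z) = 0 ↔
      ∀ t, (superSystem n m hΛ hA0 hA1).dbar t
        (fun z => f ((superCoord n m e ε).symm z)) z = 0 := by
  simp only [CRSystem.dbar, fderiv_comp_superCoord_symm, superSystem,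
    ContinuousLinearMap.mul_apply', sub_eq_zero]
  rw [cauchyRiemann_eq_zero_iff]
  simp only [partialY, partialθ]
  constructor
  · rintro ⟨h1, h2⟩ (⟨i, j⟩ | ⟨l, t⟩)
    · simp only [coordLead, coordCoeff, Sum.elim_inl, superBasis_inl]
      refine Fin.cases ?_ (fun j => ?_) j
      · rw [hA0.1, one_mul]
      · exact h1 i j
    · simp only [coordLead, coordCoeff, Sum.elim_inr, superBasis_inr]
      by_cases ht : t = S.lead (S.blockOf t)
      · have ha : (a t : Λ) = 1 := by
          rw [ht]
          exact (hA1 _).2.1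
        rw [ha, one_mul, ← ht]
      · exact h2 l (S.blockOf t) t (Finset.mem_erase.2 ⟨ht, S.mem_block_blockOf t⟩)
  · intro h
    refine ⟨fun i j => ?_, fun l k t ht => ?_⟩
    · have := h (Sum.inl ⟨i, j.succ⟩)
      simpa only [coordLead, coordCoeff, Sum.elim_inl, superBasis_inl] using this
    · have := h (Sum.inr ⟨l, t⟩)
      rw [← S.blockOf_eq_iff.2 (Finset.mem_of_mem_erase ht)]
      simpa only [coordLead, coordCoeff, Sum.elim_inr, superBasis_inr] using this

theorem differentiableAt_comp_superCoord_symm (z : EuclideanSpace ℝ (CoordIdx n m p q)) :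
    DifferentiableAt ℝ (fun z => f ((superCoord n m e ε).symm z)) z ↔
      DifferentiableAt ℝ f ((superCoord n m e ε).symm z) := by
  have h := differentiableAt_comp_symm_iff (superCoord n m e ε) f z
  exact h

theorem qsDifferentiableOn_iff (D : Set (Superspace 𝒜 n m)) :
    QSDifferentiableOn e ε S a f D ↔
      (superSystem n m hΛ hA0 hA1).IsSolOn (fun z => f ((superCoord n m e ε).symm z))
        ((superCoord n m e ε).symm ⁻¹' D) := by
  refine Iff.trans ((superCoord n m e ε).symm.surjective.forall) (forall_congr' fun z => ?_)
  exact imp_congr Iff.rfl (and_congr (differentiableAt_comp_superCoord_symm f z).symm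
    (cauchyRiemann_eq_zero_iff_dbar hΛ hA0 hA1 f z))

end Transfer

/-- There are at least two blocks of real variables. -/
theorem exists_two_blocks {n m : ℕ} (ε : Module.Basis (Fin q) ℝ (𝒜 1)) (S : BlockSeq q r)
    (hnm : 2 ≤ n + m) (hodd : 𝒜 1 = ⊥ → 2 ≤ n) :
    ∃ b j : CoordIdx n m p q, coordLead n m p S b = b ∧ coordLead n m p S j ≠ b := by
  by_cases hn : 2 ≤ n
  · refine ⟨Sum.inl ⟨⟨0, by omega⟩, 0⟩, Sum.inl ⟨⟨1, by omega⟩, 0⟩, rfl, ?_⟩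
    simp [coordLead]
  -- With at most one even variable, `Λ₁ ≠ 0` and there is an odd variable; each odd variable then
  -- contributes at least one block.
  · have hq : 0 < q := by
      rw [Nat.pos_iff_ne_zero]
      rintro rfl
      refine hn (hodd ?_)
      have : Subsingleton (𝒜 1) := ε.repr.toEquiv.subsingleton
      exact (Submodule.eq_bot_iff _).2 fun y hy => by
        simpa using congrArg Subtype.val (Subsingleton.elim (⟨y, hy⟩ : 𝒜 1) 0)
    let t₀ := S.lead (S.blockOf ⟨0, hq⟩)
    have ht₀ : S.lead (S.blockOf t₀) = t₀ := by
      simp only [t₀, S.blockOf_lead]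
    by_cases hn1 : n = 1
    · refine ⟨Sum.inl ⟨⟨0, by omega⟩, 0⟩, Sum.inr ⟨⟨0, by omega⟩, t₀⟩, rfl, ?_⟩
      simp [coordLead]
    · refine ⟨Sum.inr ⟨⟨0, by omega⟩, t₀⟩, Sum.inr ⟨⟨1, by omega⟩, t₀⟩, ?_, ?_⟩
      · simp [coordLead, ht₀]
      · simp [coordLead]

end SuperAnalysis


/-! ### Extension on the superspace. -/

theorem mainTheorem3 {Λ : Type*} [NormedRing Λ] [NormedAlgebra ℝ Λ] [FiniteDimensional ℝ Λ]
    (𝒜 : ZMod 2 → Submodule ℝ Λ) [GradedAlgebra 𝒜] (hΛ : SuperAnalysis.IsSupercommutative 𝒜)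
    {p q r : ℕ} (e : Module.Basis (Fin (p + 1)) ℝ (𝒜 0)) (hA0 : SuperAnalysis.ConditionA0 𝒜 e)
    (ε : Module.Basis (Fin q) ℝ (𝒜 1)) (S : SuperAnalysis.BlockSeq q r) (a : Fin q → 𝒜 0)
    (hA1 : SuperAnalysis.ConditionA1 𝒜 ε S a)
    {n m : ℕ} (hnm : 2 ≤ n + m)
    -- if `Λ₁ = 0`, the odd variables do not count
    (hodd : 𝒜 1 = ⊥ → 2 ≤ n)
    (Ω : Set (SuperAnalysis.Superspace 𝒜 n m)) (hΩ_open : IsOpen Ω) (hΩ_conn : IsConnected Ω)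
    (hΩ_bdd : Bornology.IsBounded Ω) (hΩ_bdry : IsConnected (frontier Ω))
    (V : Set (SuperAnalysis.Superspace 𝒜 n m)) (hV_open : IsOpen V) (hV : frontier Ω ⊆ V)
    (f : SuperAnalysis.Superspace 𝒜 n m → Λ)
    (hf : SuperAnalysis.QSDifferentiableOn e ε S a f V) :
    -- the union below is the connected component of `V` that contains `frontier Ω`
    ∃ F : SuperAnalysis.Superspace 𝒜 n m → Λ,
      SuperAnalysis.QSDifferentiableOn e ε S a F
        (Ω ∪ ⋃ b ∈ frontier Ω, connectedComponentIn V b) ∧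
      Set.EqOn F f (⋃ b ∈ frontier Ω, connectedComponentIn V b) := by
  obtain ⟨b₀, hb₀⟩ := hΩ_bdry.nonempty
  have hsub : frontier Ω ⊆ connectedComponentIn V b₀ :=
    hΩ_bdry.isPreconnected.subset_connectedComponentIn hb₀ hV
  -- The boundary is connected, so all its points have the same component in `V`.
  have hV₀ : ⋃ b ∈ frontier Ω, connectedComponentIn V b = connectedComponentIn V b₀ := by
    refine Set.Subset.antisymm (Set.iUnion₂_subset fun b hb => ?_)
      (Set.subset_biUnion_of_mem (u := fun b => connectedComponentIn V b) hb₀)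
    rw [connectedComponentIn_eq (hsub hb)]
  rw [hV₀]
  set V₀ := connectedComponentIn V b₀
  set Φ := SuperAnalysis.superCoord n m e ε with hΦ
  obtain ⟨b, j, hb, hj⟩ := SuperAnalysis.exists_two_blocks (n := n) (p := p) ε S hnm hodd
  have hbdd : Bornology.IsBounded (Φ.symm ⁻¹' Ω) := by
    rw [← Φ.image_eq_preimage_symm]
    exact Φ.lipschitz.isBounded_image hΩ_bdd
  have hconn : IsPreconnected (Φ.symm ⁻¹' V₀) := by
    rw [← Φ.image_eq_preimage_symm]
    exact isPreconnected_connectedComponentIn.image Φ Φ.continuous.continuousOn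
  have hfr : frontier (Φ.symm ⁻¹' Ω) ⊆ Φ.symm ⁻¹' V₀ := by
    have := Φ.symm.toHomeomorph.preimage_frontier Ω
    exact this.symm.subset.trans (Set.preimage_mono hsub)
  have hsol := (SuperAnalysis.qsDifferentiableOn_iff hΛ hA0 hA1 f V).1 hf
  obtain ⟨F, hF, hFf⟩ := (hsol.mono
    (Set.preimage_mono (connectedComponentIn_subset V b₀))).exists_extension (b := b) (j := j)
    hb hj (hΩ_open.preimage Φ.symm.continuous)
    (hΩ_conn.nonempty.preimage Φ.symm.surjective) hbdd
    (hV_open.connectedComponentIn.preimage Φ.symm.continuous) hconn hfr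
  refine ⟨fun x => F (Φ x), ?_, fun x hx => ?_⟩
  · rw [SuperAnalysis.qsDifferentiableOn_iff hΛ hA0 hA1]
    simpa [← hΦ] using hF
  · have := hFf (x := Φ x) (by simpa using hx)
    simpa [← hΦ] using this
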